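/- Let $n$ bidders take part in $m$ simultaneous single-item first-price auctions. Bids are arbitrary nonnegative reals. In each auction a bid of $0$ never wins; if some bid is positive, a bidder with maximal bid gets the item (by an arbitrary fixed measurable deterministic tie-breaking rule) and pays his bid; nobody else pays. Bidder $i$ has a monotone submodular valuation $v_i\colon 2^{[m]}\to\mathbb{R}_{\ge 0}$ and quasi-linear utility $u_i$, i.e. his value for the set of items he wins minus his payments. The availabilities $A_{i,j}\in\{0,1\}$ are random; if $A_{i,j}=0$, then the bid of bidder $i$ for item $j$ is replaced by $0$. Under \emph{fully independent availability} all $A_{i,j}$ are independent with $\Pr[A_{i,j}=1]=q_{i,j}$, for arbitrary $q_{i,j}\in[0,1]$. Under \emph{everybody-or-nobody admission} $A_{i,j}=A_j$ for all bidders $i$, and the $A_j$ are independent with $\Pr[A_j=1]=q_j$, for arbitrary $q_j\in[0,1]$. An \emph{availability-oblivious coarse-correlated equilibrium} is a probability distribution over bid profiles $b$, drawn independently of $A$, such that $\mathbf{E}[u_i(b_i',b_{-i})]\le\mathbf{E}[u_i(b)]$ for every bidder $i$ and every fixed bid vector $b_i'\in\mathbb{R}_{\ge0}^m$, where the expectation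 is over $b$ and $A$ and $\mathbf{E}[u_i(b)]$ is finite. The \emph{price of anarchy} of a set of outcomes is the supremum, over the outcomes in the set, of the ratio of $\mathbf{E}\bigl[\max_x\sum_i v_i(x_i)\bigr]$ to the expected social welfare of the outcome (the sum of the bidders' expected values for the items they win); the maximum is over all allocations $x$ that give each item $j$ to at most one bidder $i$, and only if $A_{i,j}=1$. (Here $0/0=0$, $x/0=\infty$ for $x>0$, and the supremum of the empty set is $0$.) Then the price of anarchy of oblivious learning, i.e. of the availability-oblivious coarse-correlated equilibria, is at most $\dfrac{1}{(1-1/e)^2}$ under fully independent availability, and at most $\dfrac{4}{(1-1/e)^3}$ under everybody-or-nobody admission. The same two bounds hold for the following larger class of outcomes. A profile of bidding strategies, each of which maps the bidder's own availability vector $(A_{i,j})_{j}$ to a bid vector, is drawn from an arbitrary joint distribution independently of $A$, and no bidder can increase his expected utility by more than $\varepsilon$ by switching to a fixed bid vector; in the limit $\varepsilon\to0^+$, the limit superior of the price of anarchy of these outcomes is at most the respective bound. -/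

import Mathlib

open MeasureTheory Filter Topology
open scoped NNReal ENNReal unitInterval

/-- A single-item first-price auction among `n` bidders, with nonnegative real bids and an arbitrary
fixed (measurable) deterministic tie-breaking rule. `winner b` is the bidder who receives the item
at the bid vector `b`, or `none` if the item is not given away. A bid of `0` never wins; as soon as
some bid is positive, the item goes to a bidder with a maximal bid. The winner pays his bid, all
other bidders pay nothing (see `Auction.payment`). -/
structure FirstPriceAuction (n : ℕ) where
  winner : (Fin n → ℝ≥0) → Option (Fin n)
  pos_of_winner : ∀ b i, winner b = some i → 0 < b i
  le_of_winner : ∀ b i, winner b = some i → ∀ k, b k ≤ b i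
  unsold : ∀ b, winner b = none → ∀ i, b i = 0
  measurableSet_winner : ∀ o, MeasurableSet (winner ⁻¹' {o})

/-- Submodularity of a set function. -/
def IsSubmodular {α : Type*} [DecidableEq α] (v : Finset α → ℝ≥0) : Prop :=
  ∀ S T, v (S ∪ T) + v (S ∩ T) ≤ v S + v T

namespace Auction

/-- Availability profiles: `A i j = true` means that item `j` is available to bidder `i`. -/
abbrev Avail (n m : ℕ) : Type := Fin n → Fin m → Bool

/-- Bid profiles: `b i j` is the bid of bidder `i` for item `j`. -/
abbrev Bids (n m : ℕ) : Type := Fin n → Fin m → ℝ≥0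

/-- Profiles of bidding strategies: a strategy of bidder `i` maps the vector of his own
availabilities to a bid for every item. -/
abbrev Strategies (n m : ℕ) : Type := Fin n → (Fin m → Bool) → Fin m → ℝ≥0

variable {n m : ℕ}

/-- The bids that are effectively placed for item `j`: a bidder to whom the item is not available
places the bid `0`. -/
def placedBids (A : Avail n m) (b : Bids n m) (j : Fin m) : Fin n → ℝ≥0 :=
  fun i => if A i j then b i j else 0

/-- The set of items that bidder `i` wins. -/
def won (M : Fin m → FirstPriceAuction n) (A : Avail n m) (b : Bids n m) (i : Fin n) :
    Finset (Fin m) :=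
  Finset.univ.filter fun j => (M j).winner (placedBids A b j) = some i

/-- The total payment of bidder `i`: his bid on each item that he wins. -/
def payment (M : Fin m → FirstPriceAuction n) (A : Avail n m) (b : Bids n m) (i : Fin n) : ℝ≥0 :=
  ∑ j ∈ won M A b i, placedBids A b j i

/-- The (quasi-linear) utility of bidder `i`. -/
def utility (M : Fin m → FirstPriceAuction n) (v : Fin n → Finset (Fin m) → ℝ≥0)
    (A : Avail n m) (b : Bids n m) (i : Fin n) : ℝ :=
  (v i (won M A b i) : ℝ) - (payment M A b i : ℝ)

/-- Fully independent availability: item `j` is available to bidder `i` with probability `q i j`,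
independently over all pairs `(i, j)`. -/
noncomputable def independentAvail (q : Fin n → Fin m → I) : Measure (Avail n m) :=
  Measure.pi fun i => Measure.pi fun j => ProbabilityTheory.bernoulliMeasure true false (q i j)

/-- Everybody-or-nobody admission: item `j` is available to all bidders with probability `q j`, and
to no bidder otherwise, independently over the items `j`. -/
noncomputable def everybodyOrNobody (n : ℕ) {m : ℕ} (q : Fin m → I) : Measure (Avail n m) :=
  (Measure.pi fun j => ProbabilityTheory.bernoulliMeasure true false (q j)).map
    fun a (_ : Fin n) => a

/-- `P` is a joint distribution of the availabilities and of the bids. No bidder can gain more than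
`ε` in expectation, over the availabilities and the bids of the other bidders, by a switch to any
other fixed bid vector `d`. The expected utility in the outcome itself is required to exist as a
finite number; after a deviation the utility of the deviating bidder is bounded. -/
def NoRegret (M : Fin m → FirstPriceAuction n) (v : Fin n → Finset (Fin m) → ℝ≥0) (ε : ℝ)
    (P : Measure (Avail n m × Bids n m)) : Prop :=
  ∀ i, Integrable (fun ω => utility M v ω.1 ω.2 i) P ∧
    ∀ d : Fin m → ℝ≥0,
      ∫ ω, utility M v ω.1 (Function.update ω.2 i d) i ∂P ≤ ∫ ω, utility M v ω.1 ω.2 i ∂P + ε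

/-- The availability-oblivious `ε`-coarse-correlated equilibria (exact ones for `ε = 0`) under the
availability law `ν`, each given as a joint law of availabilities and bids: the bid profile is drawn
from a distribution `D`, independently of the availabilities. -/
def obliviousCCE (M : Fin m → FirstPriceAuction n) (v : Fin n → Finset (Fin m) → ℝ≥0)
    (ν : Measure (Avail n m)) (ε : ℝ) : Set (Measure (Avail n m × Bids n m)) :=
  {P | ∃ D : Measure (Bids n m), IsProbabilityMeasure D ∧ P = ν.prod D ∧ NoRegret M v ε P}

/-- The larger class of outcomes in which the bidders may or may not react to their availabilities:
a profile of bidding strategies is drawn from a distribution `D`, independently of the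
availabilities, and each bidder applies his strategy to his own availabilities. No bidder gains more
than `ε` by a switch to a fixed bid vector that is oblivious to the availabilities. -/
def strategicCCE (M : Fin m → FirstPriceAuction n) (v : Fin n → Finset (Fin m) → ℝ≥0)
    (ν : Measure (Avail n m)) (ε : ℝ) : Set (Measure (Avail n m × Bids n m)) :=
  {P | ∃ D : Measure (Strategies n m), IsProbabilityMeasure D ∧
    P = (ν.prod D).map (fun ω => (ω.1, fun i => ω.2 i (ω.1 i))) ∧ NoRegret M v ε P}

/-- The maximal social welfare of an allocation `x` of the items (each to one bidder or to nobody)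
that gives every item only to a bidder to whom it is available. -/
noncomputable def optWelfare (v : Fin n → Finset (Fin m) → ℝ≥0) (A : Avail n m) : ℝ≥0 :=
  (Finset.univ.filter fun x : Fin m → Option (Fin n) => ∀ j i, x j = some i → A i j = true).sup
    fun x => ∑ i, v i (Finset.univ.filter fun j => x j = some i)

/-- The expected optimal social welfare. -/
noncomputable def expectedOpt (v : Fin n → Finset (Fin m) → ℝ≥0) (ν : Measure (Avail n m)) :
    ℝ≥0∞ :=
  ∫⁻ A, (optWelfare v A : ℝ≥0∞) ∂ν

/-- The expected social welfare in an outcome. -/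
noncomputable def expectedWelfare (M : Fin m → FirstPriceAuction n)
    (v : Fin n → Finset (Fin m) → ℝ≥0) (P : Measure (Avail n m × Bids n m)) : ℝ≥0∞ :=
  ∫⁻ ω, ((∑ i, v i (won M ω.1 ω.2 i) : ℝ≥0) : ℝ≥0∞) ∂P

/-- The price of anarchy for the set `E` of outcomes: the worst ratio of the expected optimal social
welfare to the expected social welfare in an outcome from `E` (with `0 / 0 = 0` and `x / 0 = ∞` for
`x > 0`). -/
noncomputable def priceOfAnarchy (M : Fin m → FirstPriceAuction n)
    (v : Fin n → Finset (Fin m) → ℝ≥0) (ν : Measure (Avail n m))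
    (E : Set (Measure (Avail n m × Bids n m))) : ℝ≥0∞ :=
  ⨆ P ∈ E, expectedOpt v ν / expectedWelfare M v P

end Auction

/-!
The proof is a smoothness argument: for every bidder `i` one oblivious deviation is analysed,
and the resulting bounds are summed, using that the bidders' utilities and the revenue add up to the
welfare (`Auction.welfare_bound`).

Fix an optimal allocation for every availability profile and let `y i j` be the probability that
bidder `i` gets item `j` in it. The deviation of bidder `i` bids on a random set `T` containing each
item `j` independently with probability `y i j / q i j`. The bidder then competes for `R`, the part
of `T` that is available to him, which contains each item independently with probability `y i j`.
By the correlation gap (`correlation_gap`), `E (v i R)` is at least `1 - 1/e` times his expected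
value in the optimal allocation. On the items of `T` he bids a deterministic vector `β` chosen with
respect to `w j`, the expected marginal value of `j` on top of its predecessors in `R`; by
`exists_good_bid` the bid `β j` can be chosen to gain `(1 - 1/e) * w j` minus the expected price, as
in a single auction for an item of value `w j`. For every fixed `T` this is a fixed bid vector, so
the equilibrium condition also holds on average over `T`; all such averages are finite sums
(`randSetMean`).

If availabilities are fully independent, the set of items that `β` wins is independent of the
availabilities of bidder `i`, and submodularity makes the utility at least additive with item values
`w j` (`additive_bound_of_fixed_prices`). This gives the guarantee `(1 - 1/e)^2`.

If items are available to everybody or to nobody, the bids of the others may react to the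
availabilities that determine `R`, and block an item exactly when its marginal value is high. The loss is at most the expected shortfall of
the marginal values below `w j`. Comparing `R` with the union of `R` and an independent copy of it
bounds this shortfall by half of `E (v i R)` (`randSetMean_shortfall_le`), so that the constant
`1 - 1/e` drops to `1/2 - 1/e`. This gives the guarantee `(1/2 - 1/e) * (1 - 1/e)`, which is better
than the required `(1 - 1/e)^3 / 4`.
-/

/-! ### Random sets with independent elements and the correlation gap -/

section RandomSets
variable {α : Type*} [DecidableEq α]

/-- The expectation of `f S` for a random set `S ⊆ s` that contains each `j ∈ s` independently with
probability `p j`. As a function of `p` this is the multilinear extension of `f`. -/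
noncomputable def randSetMean (s : Finset α) (p : α → ℝ) (f : Finset α → ℝ) : ℝ :=
  ∑ S ∈ s.powerset, ((∏ j ∈ S, p j) * ∏ j ∈ s \ S, (1 - p j)) * f S

namespace randSetMean

theorem congr {s : Finset α} {p : α → ℝ} {f g : Finset α → ℝ} (h : ∀ S ⊆ s, f S = g S) :
    randSetMean s p f = randSetMean s p g :=
  Finset.sum_congr rfl fun S hS => by rw [h S (Finset.mem_powerset.1 hS)]

theorem add (s : Finset α) (p : α → ℝ) (f g : Finset α → ℝ) :
    randSetMean s p (fun S => f S + g S) = randSetMean s p f + randSetMean s p g := by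
  simp [randSetMean, mul_add, Finset.sum_add_distrib]

theorem sub (s : Finset α) (p : α → ℝ) (f g : Finset α → ℝ) :
    randSetMean s p (fun S => f S - g S) = randSetMean s p f - randSetMean s p g := by
  simp [randSetMean, mul_sub, Finset.sum_sub_distrib]

theorem const_mul (s : Finset α) (p : α → ℝ) (c : ℝ) (f : Finset α → ℝ) :
    randSetMean s p (fun S => c * f S) = c * randSetMean s p f := by
  simp only [randSetMean, Finset.mul_sum]
  exact Finset.sum_congr rfl fun S _ => by ring

theorem finsetSum {ι : Type*} (t : Finset ι) (s : Finset α) (p : α → ℝ)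
    (f : ι → Finset α → ℝ) :
    randSetMean s p (fun S => ∑ k ∈ t, f k S) = ∑ k ∈ t, randSetMean s p (f k) := by
  simp only [randSetMean, Finset.mul_sum]
  exact Finset.sum_comm

theorem insert {s : Finset α} {a : α} (ha : a ∉ s) (p : α → ℝ) (f : Finset α → ℝ) :
    randSetMean (insert a s) p f =
      (1 - p a) * randSetMean s p f + p a * randSetMean s p (fun S => f (insert a S)) := by
  unfold randSetMean
  rw [Finset.sum_powerset_insert ha, Finset.mul_sum, Finset.mul_sum]
  congr 1 <;> refine Finset.sum_congr rfl fun S hS => ?_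
  · have hS' := Finset.mem_powerset.1 hS
    have haS : a ∉ S := fun h => ha (hS' h)
    rw [Finset.insert_sdiff_of_notMem _ haS, Finset.prod_insert (by simp [ha])]
    ring
  · have hS' := Finset.mem_powerset.1 hS
    have haS : a ∉ S := fun h => ha (hS' h)
    rw [Finset.insert_sdiff_insert, Finset.prod_insert haS,
      Finset.sdiff_insert_of_notMem ha]
    ring

theorem const (s : Finset α) (p : α → ℝ) (c : ℝ) : randSetMean s p (fun _ => c) = c := by
  induction s using Finset.induction_on with
  | empty => simp [randSetMean]
  | insert a s ha ih => rw [insert ha, ih]; ring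

theorem mono {s : Finset α} {p : α → ℝ} (hp0 : ∀ j, 0 ≤ p j) (hp1 : ∀ j, p j ≤ 1)
    {f g : Finset α → ℝ} (h : ∀ S ⊆ s, f S ≤ g S) :
    randSetMean s p f ≤ randSetMean s p g :=
  Finset.sum_le_sum fun S hS => mul_le_mul_of_nonneg_left (h S (Finset.mem_powerset.1 hS)) <|
    mul_nonneg (Finset.prod_nonneg fun j _ => hp0 j)
      (Finset.prod_nonneg fun j _ => sub_nonneg.2 (hp1 j))

/-- The event `j ∈ S` is independent of the other coordinates of the random set. -/
theorem mem {s : Finset α} {j : α} (hj : j ∈ s) (p : α → ℝ) (f : Finset α → ℝ) :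
    randSetMean s p (fun S => if j ∈ S then f S else 0) =
      p j * randSetMean s p (fun S => f (Insert.insert j S)) := by
  obtain ⟨t, hjt, rfl⟩ : ∃ t, j ∉ t ∧ Insert.insert j t = s :=
    ⟨s.erase j, Finset.notMem_erase j s, Finset.insert_erase hj⟩
  rw [insert hjt, insert hjt]
  have h0 : randSetMean t p (fun S => if j ∈ S then f S else 0) = 0 := by
    rw [congr (g := fun _ => 0), const]
    intro S hS
    rw [if_neg fun h => hjt (hS h)]
  simp only [h0, Finset.mem_insert_self, if_true, Finset.insert_idem]
  ring

/-- Independent thinning: the intersection of two independent random sets. -/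
theorem inter (s : Finset α) (p r : α → ℝ) (f : Finset α → ℝ) :
    randSetMean s p (fun S => randSetMean s r fun T => f (S ∩ T)) =
      randSetMean s (fun j => p j * r j) f := by
  induction s using Finset.induction_on generalizing f with
  | empty => simp [randSetMean]
  | insert a s ha ih =>
    rw [insert ha, insert ha]
    simp only [insert ha, add, const_mul]
    rw [← ih, ← ih]
    have h1 : randSetMean s p (fun S => randSetMean s r fun T => f (S ∩ Insert.insert a T)) =
        randSetMean s p (fun S => randSetMean s r fun T => f (S ∩ T)) :=
      congr fun S hS => congr fun T _ => by
        rw [Finset.inter_insert_of_notMem fun h => ha (hS h)]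
    have h2 : randSetMean s p (fun S => randSetMean s r fun T => f (Insert.insert a S ∩ T)) =
        randSetMean s p (fun S => randSetMean s r fun T => f (S ∩ T)) :=
      congr fun S _ => congr fun T hT => by
        rw [Finset.insert_inter_of_notMem fun h => ha (hT h)]
    simp only [← Finset.insert_inter_distrib, h1, h2]
    ring

theorem union (s : Finset α) (p r : α → ℝ) (f : Finset α → ℝ) :
    randSetMean s p (fun S => randSetMean s r fun T => f (S ∪ T)) =
      randSetMean s (fun j => p j + r j - p j * r j) f := by
  induction s using Finset.induction_on generalizing f with
  | empty => simp [randSetMean]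
  | insert a s ha ih =>
    rw [insert ha, insert ha]
    simp only [insert ha, add, const_mul]
    rw [← ih, ← ih]
    simp only [Finset.insert_union, Finset.union_insert, Finset.insert_idem]
    ring

theorem hasDerivAt_line (s : Finset α) (x : α → ℝ) (f : Finset α → ℝ) (t : ℝ) :
    HasDerivAt (fun t : ℝ => randSetMean s (fun j => t * x j) f)
      (∑ j ∈ s, x j * randSetMean s (fun j => t * x j)
        (fun S => f (Insert.insert j S) - f (S.erase j))) t := by
  induction s using Finset.induction_on generalizing f with
  | empty => simpa [randSetMean] using hasDerivAt_const t (f ∅)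
  | insert a s ha ih =>
    simp only [insert ha]
    have hlin : HasDerivAt (fun t : ℝ => t * x a) (x a) t := by
      simpa using (hasDerivAt_id t).mul_const (x a)
    have h := ((hlin.const_sub 1).mul (ih f)).add
      (hlin.mul (ih fun S => f (Insert.insert a S)))
    refine h.congr_deriv ?_
    rw [Finset.sum_insert ha]
    have e1 : randSetMean s (fun j => t * x j) (fun S => f (Insert.insert a S) - f (S.erase a)) =
        randSetMean s (fun j => t * x j) (fun S => f (Insert.insert a S)) -
          randSetMean s (fun j => t * x j) f := by
      rw [← sub]
      exact congr fun S hS => by rw [Finset.erase_eq_of_notMem fun h => ha (hS h)]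
    have e2 : randSetMean s (fun j => t * x j)
        (fun S => f (Insert.insert a (Insert.insert a S)) - f ((Insert.insert a S).erase a)) =
        randSetMean s (fun j => t * x j) (fun S => f (Insert.insert a S)) -
          randSetMean s (fun j => t * x j) f := by
      rw [← sub]
      exact congr fun S hS => by
        rw [Finset.insert_idem, Finset.erase_insert fun h => ha (hS h)]
    have e3 : ∀ j ∈ s, randSetMean s (fun j => t * x j)
          (fun S => f (Insert.insert j (Insert.insert a S)) - f ((Insert.insert a S).erase j)) =
        randSetMean s (fun j => t * x j)
          (fun S => f (Insert.insert a (Insert.insert j S)) - f (Insert.insert a (S.erase j))) := by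
      intro j hj
      have hja : a ≠ j := fun h => ha (h ▸ hj)
      exact congr fun S hS => by
        rw [Finset.insert_comm, Finset.erase_insert_of_ne hja]
    rw [e1, e2]
    have e4 : ∑ j ∈ s, x j * ((1 - t * x a) * randSetMean s (fun j => t * x j)
          (fun S => f (Insert.insert j S) - f (S.erase j)) + t * x a *
          randSetMean s (fun j => t * x j)
          (fun S => f (Insert.insert j (Insert.insert a S)) - f ((Insert.insert a S).erase j))) =
        (1 - t * x a) * (∑ j ∈ s, x j * randSetMean s (fun j => t * x j)
          (fun S => f (Insert.insert j S) - f (S.erase j))) +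
        t * x a * ∑ j ∈ s, x j * randSetMean s (fun j => t * x j)
          (fun S => f (Insert.insert a (Insert.insert j S)) - f (Insert.insert a (S.erase j))) := by
      rw [Finset.mul_sum, Finset.mul_sum, ← Finset.sum_add_distrib]
      exact Finset.sum_congr rfl fun j hj => by rw [e3 j hj]; ring
    rw [e4]
    ring

end randSetMean

/-- The correlation gap of a monotone set function. The hypothesis `hV` holds if `v` is submodular
and `V` is the mean of `v` under any distribution on sets with marginals `x`. Along the ray
`t ↦ t • x`, the multilinear extension `F` satisfies `F' ≥ V - F`, so `exp t * (F - V)`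
increases. -/
theorem correlation_gap [Fintype α] {v : Finset α → ℝ} (hmono : Monotone v) (h0 : 0 ≤ v ∅)
    {x : α → ℝ} (hx0 : ∀ j, 0 ≤ x j) (hx1 : ∀ j, x j ≤ 1) {V : ℝ}
    (hV : ∀ S, V ≤ v S + ∑ j, x j * (v (insert j S) - v S)) :
    (1 - 1 / Real.exp 1) * V ≤ randSetMean Finset.univ x v := by
  set F : ℝ → ℝ := fun t => randSetMean Finset.univ (fun j => t * x j) v with hF
  set F' : ℝ → ℝ := fun t => ∑ j, x j * randSetMean Finset.univ (fun j => t * x j)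
        (fun S => v (insert j S) - v (S.erase j)) with hF'
  have hd : ∀ t, HasDerivAt F (F' t) t := fun t =>
    randSetMean.hasDerivAt_line Finset.univ x v t
  have hge : ∀ t ∈ Set.Icc (0 : ℝ) 1, V ≤ F t + F' t := by
    intro t ht
    have hp0 : ∀ j, 0 ≤ t * x j := fun j => mul_nonneg ht.1 (hx0 j)
    have hp1 : ∀ j, t * x j ≤ 1 := fun j => mul_le_one₀ ht.2 (hx0 j) (hx1 j)
    have h1 : V ≤ randSetMean Finset.univ (fun j => t * x j)
        (fun S => v S + ∑ j, x j * (v (insert j S) - v (S.erase j))) := by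
      rw [← randSetMean.const Finset.univ (fun j => t * x j) V]
      refine randSetMean.mono hp0 hp1 fun S _ => (hV S).trans ?_
      gcongr with j _
      · exact hx0 j
      · exact hmono (Finset.erase_subset _ _)
    rw [randSetMean.add, randSetMean.finsetSum] at h1
    simpa only [randSetMean.const_mul] using h1
  have hmon : MonotoneOn (fun t => Real.exp t * (F t - V)) (Set.Icc 0 1) := by
    have hdd : ∀ t, HasDerivAt (fun t => Real.exp t * (F t - V))
        (Real.exp t * (F t - V) + Real.exp t * F' t) t := fun t =>
      (Real.hasDerivAt_exp t).mul ((hd t).sub_const V)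
    refine monotoneOn_of_deriv_nonneg (convex_Icc 0 1)
      (fun t _ => (hdd t).continuousAt.continuousWithinAt)
      (fun t _ => (hdd t).differentiableAt.differentiableWithinAt) fun t ht => ?_
    rw [(hdd t).deriv, ← mul_add]
    have := hge t (interior_subset ht)
    exact mul_nonneg (Real.exp_pos t).le (by linarith)
  have h01 := hmon (Set.left_mem_Icc.2 zero_le_one) (Set.right_mem_Icc.2 zero_le_one) zero_le_one
  have hF0 : 0 ≤ F 0 := by
    refine (randSetMean.const Finset.univ (fun j : α => 0 * x j) 0).symm.le.trans ?_
    exact randSetMean.mono (p := fun j => 0 * x j) (by simp) (by simp) fun S _ =>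
      h0.trans (hmono (Finset.empty_subset S))
  have hF1 : F 1 = randSetMean Finset.univ x v := by simp [hF]
  simp only [Real.exp_zero, one_mul, hF1] at h01
  have he : 0 < Real.exp 1 := Real.exp_pos 1
  have : (1 - 1 / Real.exp 1) * V = V - V / Real.exp 1 := by ring
  rw [this, sub_le_iff_le_add, ← sub_le_iff_le_add', le_div_iff₀ he]
  nlinarith

end RandomSets

/-! ### Marginal values along a linear order -/

section OrderedMarginals
variable {α : Type*} [LinearOrder α]

/-- The marginal value of `j` on top of the elements of `S` that precede `j`. -/
def precMarginal (v : Finset α → ℝ) (S : Finset α) (j : α) : ℝ :=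
  v (insert j (S.filter (· < j))) - v (S.filter (· < j))

/-- Decreasing marginal values; for monotone set functions this is equivalent to submodularity. -/
def DecreasingMarginals (v : Finset α → ℝ) : Prop :=
  ∀ ⦃S T : Finset α⦄, S ⊆ T → ∀ j, v (insert j T) - v T ≤ v (insert j S) - v S

theorem add_sum_precMarginal (v : Finset α → ℝ) (S : Finset α) :
    v ∅ + ∑ j ∈ S, precMarginal v S j = v S := by
  induction S using Finset.induction_on_max with
  | empty => simp
  | insert a S ha ih =>
    have haS : a ∉ S := fun h => lt_irrefl _ (ha a h)
    have h1 : (insert a S).filter (· < a) = S := by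
      rw [Finset.filter_insert, if_neg (lt_irrefl a)]
      exact Finset.filter_true_of_mem ha
    have h2 : ∀ j ∈ S, precMarginal v (insert a S) j = precMarginal v S j := fun j hj => by
      rw [precMarginal, precMarginal, Finset.filter_insert, if_neg (ha j hj).le.not_gt]
    rw [Finset.sum_insert haS, Finset.sum_congr rfl h2, precMarginal, h1]
    linarith

theorem precMarginal_anti {v : Finset α → ℝ} (hv : DecreasingMarginals v) {S T : Finset α}
    (h : S ⊆ T) (j : α) : precMarginal v T j ≤ precMarginal v S j :=
  hv (Finset.filter_subset_filter _ h) j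

theorem precMarginal_nonneg {v : Finset α → ℝ} (hv : Monotone v) (S : Finset α) (j : α) :
    0 ≤ precMarginal v S j :=
  sub_nonneg.2 (hv (Finset.subset_insert _ _))

theorem precMarginal_insert_self (v : Finset α → ℝ) (S : Finset α) (j : α) :
    precMarginal v (insert j S) j = precMarginal v S j := by
  rw [precMarginal, precMarginal, Finset.filter_insert, if_neg (lt_irrefl j)]

/-- If the set `Z` of items for which `β` is a winning bid may depend on `R`, the additive lower
bound still holds up to the shortfall of the marginal values below the item values `w`. -/
theorem additive_bound_with_shortfall {v : Finset α → ℝ} (hsub : DecreasingMarginals v)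
    (w β : α → ℝ) (R Z : Finset α) :
    v ∅ + ∑ j ∈ R ∩ Z, (w j - β j) - ∑ j ∈ R, max (w j - precMarginal v R j) 0 ≤
      v (R ∩ Z) - ∑ j ∈ R ∩ Z, β j := by
  have h1 : ∑ j ∈ R ∩ Z, max (w j - precMarginal v R j) 0 ≤
      ∑ j ∈ R, max (w j - precMarginal v R j) 0 :=
    Finset.sum_le_sum_of_subset_of_nonneg Finset.inter_subset_left fun j _ _ => le_max_right _ _
  have h2 : ∑ j ∈ R ∩ Z, (w j - max (w j - precMarginal v R j) 0) ≤
      ∑ j ∈ R ∩ Z, precMarginal v (R ∩ Z) j :=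
    Finset.sum_le_sum fun j _ => by
      have := precMarginal_anti hsub (Finset.inter_subset_left : R ∩ Z ⊆ R) j
      have := le_max_left (w j - precMarginal v R j) 0
      linarith
  rw [Finset.sum_sub_distrib] at h2
  rw [← add_sum_precMarginal v (R ∩ Z), Finset.sum_sub_distrib]
  linarith

variable [Fintype α]

/-- The mean marginal value of `j` on top of its predecessors in the random set that contains each
element independently with probability `x j`. -/
noncomputable def meanMarginal (v : Finset α → ℝ) (x : α → ℝ) (j : α) : ℝ :=
  randSetMean Finset.univ x fun S => precMarginal v S j

theorem meanMarginal_nonneg {v : Finset α → ℝ} (hv : Monotone v) {x : α → ℝ}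
    (hx0 : ∀ j, 0 ≤ x j) (hx1 : ∀ j, x j ≤ 1) (j : α) : 0 ≤ meanMarginal v x j := by
  rw [← randSetMean.const Finset.univ x 0]
  exact randSetMean.mono hx0 hx1 fun S _ => precMarginal_nonneg hv S j

/-- Whether `j` belongs to the random set is independent of any `f` that does not depend on `j`. -/
theorem randSetMean_sum_mem (x : α → ℝ) (f : Finset α → α → ℝ)
    (hf : ∀ S j, f (insert j S) j = f S j) :
    randSetMean Finset.univ x (fun S => ∑ j ∈ S, f S j) =
      ∑ j, x j * randSetMean Finset.univ x (fun S => f S j) := by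
  have h1 : ∀ S : Finset α, ∑ j ∈ S, f S j = ∑ j, if j ∈ S then f S j else 0 := fun S => by
    rw [← Finset.sum_filter, Finset.filter_mem_eq_inter, Finset.univ_inter]
  simp only [h1, randSetMean.finsetSum]
  refine Finset.sum_congr rfl fun j _ => ?_
  rw [randSetMean.mem (Finset.mem_univ j)]
  simp only [hf]

theorem add_sum_meanMarginal (v : Finset α → ℝ) (x : α → ℝ) :
    v ∅ + ∑ j, x j * meanMarginal v x j = randSetMean Finset.univ x v := by
  have h := randSetMean_sum_mem x (precMarginal v) (precMarginal_insert_self v)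
  unfold meanMarginal
  rw [← h, ← randSetMean.const Finset.univ x (v ∅), ← randSetMean.add]
  simp only [add_sum_precMarginal]

/-- If the set `Z` of items for which `β` is a winning bid is fixed, then an additive lower bound
with the mean marginal values as item values holds for the utility from bidding on a random set. -/
theorem additive_bound_of_fixed_prices {v : Finset α → ℝ} (hsub : DecreasingMarginals v)
    {x : α → ℝ} (hx0 : ∀ j, 0 ≤ x j) (hx1 : ∀ j, x j ≤ 1) (Z : Finset α) (β : α → ℝ) :
    v ∅ + ∑ j ∈ Z, x j * (meanMarginal v x j - β j) ≤
      randSetMean Finset.univ x (fun R => v (R ∩ Z) - ∑ j ∈ R ∩ Z, β j) := by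
  have h1 : ∀ R : Finset α, v ∅ + ∑ j ∈ R, (if j ∈ Z then precMarginal v R j - β j else 0) ≤
      v (R ∩ Z) - ∑ j ∈ R ∩ Z, β j := by
    intro R
    rw [← Finset.sum_filter, Finset.filter_mem_eq_inter, ← add_sum_precMarginal v (R ∩ Z),
      Finset.sum_sub_distrib]
    have : ∑ j ∈ R ∩ Z, precMarginal v R j ≤ ∑ j ∈ R ∩ Z, precMarginal v (R ∩ Z) j :=
      Finset.sum_le_sum fun j _ => precMarginal_anti hsub Finset.inter_subset_left j
    linarith
  refine le_trans (le_of_eq ?_) (randSetMean.mono hx0 hx1 fun R _ => h1 R)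
  rw [randSetMean.add, randSetMean.const, randSetMean_sum_mem x
    (fun R j => if j ∈ Z then precMarginal v R j - β j else 0)
    (fun R j => by rw [precMarginal_insert_self]), ← Finset.sum_filter_add_sum_filter_not
      Finset.univ (· ∈ Z), Finset.filter_mem_eq_inter, Finset.univ_inter]
  rw [Finset.sum_eq_zero (s := Finset.univ.filter (· ∉ Z)), add_zero]
  · congr 1
    refine Finset.sum_congr rfl fun j hj => ?_
    simp only [hj, if_true]
    rw [randSetMean.sub, randSetMean.const, meanMarginal]
  · intro j hj
    simp only [(Finset.mem_filter.1 hj).2, if_false, randSetMean.const, mul_zero]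

/-- The expected shortfall of the marginal values below their means is at most half of the sum of
the means. With an independent copy `R'` of `R`, the shortfall is bounded through the marginal values
on top of `R ∪ R'`, and each element is in `R ∪ R'` at most twice as likely as in `R`. -/
theorem randSetMean_shortfall_le {v : Finset α → ℝ} (hmono : Monotone v)
    (hsub : DecreasingMarginals v) {x : α → ℝ} (hx0 : ∀ j, 0 ≤ x j) (hx1 : ∀ j, x j ≤ 1) :
    randSetMean Finset.univ x
        (fun R => ∑ j ∈ R, max (meanMarginal v x j - precMarginal v R j) 0) ≤
      (∑ j, x j * meanMarginal v x j) / 2 := by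
  set y : α → ℝ := fun j => x j + x j - x j * x j with hy
  have hy0 : ∀ j, 0 ≤ y j := fun j => by
    have := mul_nonneg (hx0 j) (sub_nonneg.2 (hx1 j))
    have := hx0 j
    simp only [hy]; nlinarith
  have hy2 : ∀ j, y j ≤ 2 * x j := fun j => by
    have := mul_self_nonneg (x j)
    simp only [hy]; linarith
  have hshort : ∀ j, randSetMean Finset.univ x
      (fun R => max (meanMarginal v x j - precMarginal v R j) 0) ≤
      meanMarginal v x j - meanMarginal v y j := by
    intro j
    have h1 : ∀ R ⊆ (Finset.univ : Finset α), max (meanMarginal v x j - precMarginal v R j) 0 ≤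
        meanMarginal v x j - randSetMean Finset.univ x (fun R' => precMarginal v (R ∪ R') j) := by
      intro R _
      refine max_le ?_ (sub_nonneg.2 ?_)
      · refine sub_le_sub_left ?_ _
        rw [← randSetMean.const Finset.univ x (precMarginal v R j)]
        exact randSetMean.mono hx0 hx1 fun R' _ =>
          precMarginal_anti hsub Finset.subset_union_left j
      · exact randSetMean.mono hx0 hx1 fun R' _ =>
          precMarginal_anti hsub Finset.subset_union_right j
    refine (randSetMean.mono hx0 hx1 h1).trans (le_of_eq ?_)
    rw [randSetMean.sub, randSetMean.const,
      randSetMean.union _ _ _ fun S => precMarginal v S j]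
    rfl
  rw [randSetMean_sum_mem x (fun R j => max (meanMarginal v x j - precMarginal v R j) 0)
    (fun R j => by rw [precMarginal_insert_self])]
  have hF : randSetMean Finset.univ x v ≤ randSetMean Finset.univ y v := by
    rw [← randSetMean.union]
    refine randSetMean.mono hx0 hx1 fun R _ => ?_
    rw [← randSetMean.const Finset.univ x (v R)]
    exact randSetMean.mono hx0 hx1 fun R' _ => hmono Finset.subset_union_left
  rw [← add_sum_meanMarginal, ← add_sum_meanMarginal] at hF
  have h2 : ∑ j, y j * meanMarginal v y j ≤ 2 * ∑ j, x j * meanMarginal v y j := by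
    rw [Finset.mul_sum]
    refine Finset.sum_le_sum fun j _ => ?_
    rw [← mul_assoc]
    refine mul_le_mul_of_nonneg_right (hy2 j) (meanMarginal_nonneg hmono hy0 (fun j => ?_) j)
    have := mul_self_nonneg (1 - x j)
    simp only [hy]; linarith
  have h3 := Finset.sum_le_sum fun j (_ : j ∈ Finset.univ) =>
    mul_le_mul_of_nonneg_left (hshort j) (hx0 j)
  simp only [mul_sub, Finset.sum_sub_distrib] at h3
  linarith

end OrderedMarginals

/-! ### A single bid against random prices -/

section PostedBid

/-- Against random prices `p` there is a single bid `β ≤ w` whose expected gain for an item of value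
`w` is at least `(1 - 1/e) w` minus the expected price. Otherwise `μ {p < β} < K / (w - β)` for all
`β`, and integrating over `β ∈ [0, (1 - 1/e) w]`, where `1 / (w - β)` has integral `1`, gives a
contradiction. -/
theorem exists_good_bid {Ω : Type*} [MeasurableSpace Ω] (μ : Measure Ω) [IsFiniteMeasure μ]
    {p : Ω → ℝ} (hp : Measurable p) (hp0 : ∀ ω, 0 ≤ p ω) (hpi : Integrable p μ) {w : ℝ}
    (hw : 0 ≤ w) :
    ∃ β, 0 ≤ β ∧ β ≤ w ∧
      (1 - 1 / Real.exp 1) * w * μ.real Set.univ - ∫ ω, p ω ∂μ ≤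
        μ.real {ω | p ω < β} * (w - β) := by
  set c : ℝ := 1 - 1 / Real.exp 1 with hc
  set K : ℝ := c * w * μ.real Set.univ - ∫ ω, p ω ∂μ with hK
  have he : 1 < Real.exp 1 := by simp
  have hc0 : 0 < c := by
    have : 1 / Real.exp 1 < 1 := by rw [div_lt_one (by positivity)]; exact he
    linarith
  have hc1 : c < 1 := by
    have : 0 < 1 / Real.exp 1 := by positivity
    linarith
  have hpint : 0 ≤ ∫ ω, p ω ∂μ := integral_nonneg hp0
  rcases hw.eq_or_lt with rfl | hw
  · exact ⟨0, le_rfl, le_rfl, by simp [hK]; exact hpint⟩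
  by_contra! hcon
  have hcw : c * w < w := by nlinarith
  have hcw0 : 0 < c * w := by positivity
  have hG : Monotone fun β : ℝ => μ.real {ω | p ω < β} := fun a b hab =>
    measureReal_mono fun ω (h : p ω < a) => h.trans_le hab
  have hGi : IntervalIntegrable (fun β : ℝ => μ.real {ω | p ω < β}) volume 0 (c * w) :=
    (hG.monotoneOn _).intervalIntegrable
  have hinv : ContinuousOn (fun β : ℝ => K * (w - β)⁻¹) (Set.uIcc 0 (c * w)) := by
    rw [Set.uIcc_of_le hcw0.le]
    refine continuousOn_const.mul (ContinuousOn.inv₀ (by fun_prop) fun β hβ => ?_)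
    have := hβ.2
    linarith
  have hKi := hinv.intervalIntegrable (μ := volume)
  have hpos := intervalIntegral.intervalIntegral_pos_of_pos_on (hKi.sub hGi) (fun β hβ => by
    have h1 : 0 < w - β := by linarith [hβ.2]
    have h2 := hcon β hβ.1.le (by linarith)
    have : μ.real {ω | p ω < β} < K * (w - β)⁻¹ := by
      rw [← div_eq_mul_inv, lt_div_iff₀ h1]; exact h2
    exact sub_pos.2 this) hcw0
  have hlog : ∫ β in (0 : ℝ)..(c * w), (w - β)⁻¹ = 1 := by
    rw [intervalIntegral.integral_comp_sub_left (fun x => x⁻¹) w, sub_zero, integral_inv_of_pos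
      (by linarith) hw]
    have : w / (w - c * w) = Real.exp 1 := by
      rw [hc]; field_simp; ring
    rw [this, Real.log_exp]
  rw [intervalIntegral.integral_sub hKi hGi, intervalIntegral.integral_const_mul, hlog,
    mul_one] at hpos
  have hfub : ∫ β in (0 : ℝ)..(c * w), μ.real {ω | p ω < β} =
      ∫ ω, (∫ β in Set.Ioc 0 (c * w), (Set.Ioi (p ω)).indicator (fun _ => (1 : ℝ)) β) ∂μ := by
    rw [intervalIntegral.integral_of_le hcw0.le, integral_integral_swap]
    · refine integral_congr_ae (Eventually.of_forall fun β => ?_)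
      have : (fun ω => (Set.Ioi (p ω)).indicator (fun _ => (1 : ℝ)) β) =
          Set.indicator {ω | p ω < β} (fun _ => (1 : ℝ)) := by
        ext ω; simp [Set.indicator]
      simp only [this]
      rw [integral_indicator_const _ (measurableSet_lt hp measurable_const)]
      simp
    · have hm : MeasurableSet {z : Ω × ℝ | p z.1 < z.2} :=
        measurableSet_lt (hp.comp measurable_fst) measurable_snd
      exact ((integrable_const (1 : ℝ)).indicator hm)
  have hin : ∀ ω, c * w - p ω ≤
      ∫ β in Set.Ioc 0 (c * w), (Set.Ioi (p ω)).indicator (fun _ => (1 : ℝ)) β := by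
    intro ω
    rw [integral_indicator_const _ measurableSet_Ioi, measureReal_restrict_apply measurableSet_Ioi]
    have h : Set.Ioi (p ω) ∩ Set.Ioc 0 (c * w) = Set.Ioc (p ω) (c * w) := by
      ext β
      simp only [Set.mem_inter_iff, Set.mem_Ioi, Set.mem_Ioc]
      exact ⟨fun h => ⟨h.1, h.2.2⟩, fun h => ⟨h.1, (hp0 ω).trans_lt h.1, h.2⟩⟩
    rw [h, smul_eq_mul, mul_one, Real.volume_real_Ioc]
    exact le_max_left _ _
  have hfin : K ≤ ∫ ω, (∫ β in Set.Ioc 0 (c * w),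
      (Set.Ioi (p ω)).indicator (fun _ => (1 : ℝ)) β) ∂μ := by
    have h1 : K = ∫ ω, (c * w - p ω) ∂μ := by
      rw [integral_sub (integrable_const _) hpi, integral_const, smul_eq_mul, hK]
      ring
    rw [h1]
    refine integral_mono ((integrable_const _).sub hpi) ?_ hin
    have hm : MeasurableSet {z : Ω × ℝ | p z.1 < z.2} :=
      measurableSet_lt (hp.comp measurable_fst) measurable_snd
    exact ((integrable_const (1 : ℝ)).indicator (μ := μ.prod (volume.restrict (Set.Ioc 0 (c * w))))
      hm).integral_prod_left
  linarith

end PostedBid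

/-! ### Laws of random sets -/

namespace randSetMean

variable {α : Type*} [DecidableEq α]

theorem integral {Ω : Type*} [MeasurableSpace Ω] {μ : Measure Ω} {s : Finset α} {p : α → ℝ}
    {f : Finset α → Ω → ℝ} (hf : ∀ S, Integrable (f S) μ) :
    randSetMean s p (fun S => ∫ ω, f S ω ∂μ) = ∫ ω, randSetMean s p (fun S => f S ω) ∂μ := by
  simp only [randSetMean]
  rw [integral_finsetSum _ fun S _ => (hf S).const_mul _]
  simp only [integral_const_mul]

end randSetMean

theorem measurable_comp_filter {Ω ι β : Type*} [MeasurableSpace Ω] [MeasurableSpace β] [Fintype ι]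
    {p : Ω → ι → Prop} [∀ ω, DecidablePred (p ω)] (hp : ∀ j, MeasurableSet {ω | p ω j})
    (g : Finset ι → β) : Measurable fun ω => g (Finset.univ.filter (p ω)) := by
  let : MeasurableSpace (Finset ι) := ⊤
  refine (measurable_from_top (f := g)).comp (measurable_to_countable' fun S => ?_)
  have : (fun ω => Finset.univ.filter (p ω)) ⁻¹' {S} =
      ⋂ j, {ω | p ω j ↔ j ∈ S} := by
    ext ω
    simp [Finset.ext_iff]
  rw [this]
  refine MeasurableSet.iInter fun j => ?_
  by_cases hj : j ∈ S
  · simpa [hj] using hp j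
  · simp only [hj, iff_false]
    exact (hp j).compl

theorem integrable_comp_finset {Ω ι : Type*} [MeasurableSpace Ω] [Fintype ι] {μ : Measure Ω}
    [IsFiniteMeasure μ] (F : Ω → Finset ι) (g : Finset ι → ℝ)
    (hF : Measurable fun ω => g (F ω)) : Integrable (fun ω => g (F ω)) μ := by
  refine Integrable.of_bound hF.aestronglyMeasurable (∑ S, ‖g S‖) (Eventually.of_forall fun ω => ?_)
  exact Finset.single_le_sum (f := fun S => ‖g S‖) (fun S _ => norm_nonneg _) (Finset.mem_univ _)

theorem IsSubmodular.decreasingMarginals {α : Type*} [LinearOrder α] {v : Finset α → ℝ≥0}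
    (hsub : IsSubmodular v) (hmono : Monotone v) :
    DecreasingMarginals fun S => (v S : ℝ) := by
  intro S T hST j
  by_cases hj : j ∈ T
  · rw [Finset.insert_eq_of_mem hj, sub_self]
    exact sub_nonneg.2 (NNReal.coe_le_coe.2 (hmono (Finset.subset_insert _ _)))
  · have h := hsub T (insert j S)
    rw [Finset.union_insert, Finset.union_eq_left.2 hST, Finset.inter_insert_of_notMem hj,
      Finset.inter_eq_right.2 hST] at h
    have h' : (v (insert j T) : ℝ) + v S ≤ v T + v (insert j S) := by exact_mod_cast h
    simp only
    linarith

/-- Adding the elements of `T` to `S` one by one. -/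
theorem DecreasingMarginals.le_add_sum {α : Type*} [LinearOrder α] {v : Finset α → ℝ}
    (hsub : DecreasingMarginals v) (hmono : Monotone v) (S T : Finset α) :
    v T ≤ v S + ∑ j ∈ T, (v (insert j S) - v S) := by
  refine (hmono (Finset.subset_union_left (s₂ := S))).trans ?_
  induction T using Finset.induction_on with
  | empty => simp
  | insert a T ha ih =>
    rw [Finset.sum_insert ha, Finset.insert_union]
    have := hsub (Finset.subset_union_right : S ⊆ T ∪ S) a
    linarith

/-- A monotone submodular valuation loses at most a factor `1 - 1/e` when a random set `X` is
replaced by the random set of independent elements with the same marginals. -/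
theorem correlation_gap_integral {α Ω : Type*} [LinearOrder α] [Fintype α] [MeasurableSpace Ω]
    {μ : Measure Ω} [IsProbabilityMeasure μ] {v : Finset α → ℝ} (hmono : Monotone v) (h0 : 0 ≤ v ∅)
    (hsub : DecreasingMarginals v) (X : Ω → Finset α)
    (hX : ∀ g : Finset α → ℝ, Measurable fun ω => g (X ω)) :
    (1 - 1 / Real.exp 1) * ∫ ω, v (X ω) ∂μ ≤
      randSetMean Finset.univ (fun j => μ.real {ω | j ∈ X ω}) v := by
  refine correlation_gap hmono h0 (fun j => measureReal_nonneg) (fun j => measureReal_le_one)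
    fun S => ?_
  have hmeas : ∀ j, MeasurableSet {ω | j ∈ X ω} := fun j => by
    have := measurableSet_eq_fun (hX fun S => if j ∈ S then (1 : ℝ) else 0)
      (measurable_const (a := (1 : ℝ)))
    convert this using 2
    simp
  have hS : ∀ ω, v (X ω) ≤ v S + ∑ j, {ω | j ∈ X ω}.indicator
      (fun _ => v (insert j S) - v S) ω := fun ω => by
    refine (hsub.le_add_sum hmono S (X ω)).trans (le_of_eq ?_)
    congr 1
    simp only [Set.indicator_apply, Set.mem_ofPred_eq]
    rw [← Finset.sum_filter, Finset.filter_mem_eq_inter, Finset.univ_inter]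
  have hi : ∀ j, Integrable ({ω | j ∈ X ω}.indicator fun _ => v (insert j S) - v S) μ := fun j =>
    (integrable_const _).indicator (hmeas j)
  refine (integral_mono (integrable_comp_finset X v (hX v))
    ((integrable_const _).add (integrable_finsetSum _ fun j _ => hi j)) hS).trans (le_of_eq ?_)
  rw [integral_add' (integrable_const _) (integrable_finsetSum _ fun j _ => hi j),
    integral_finsetSum _ fun j _ => hi j]
  simp [integral_indicator_const _ (hmeas _)]

/-- The random set of available items under independent Bernoulli availabilities. -/
theorem integral_pi_bernoulli {ι : Type*} [Fintype ι] [DecidableEq ι] (q : ι → I)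
    (g : Finset ι → ℝ) :
    ∫ a, g (Finset.univ.filter fun j => a j = true)
        ∂(Measure.pi fun j => ProbabilityTheory.bernoulliMeasure true false (q j)) =
      randSetMean Finset.univ (fun j => (q j : ℝ)) g := by
  rw [integral_fintype .of_finite, randSetMean, Finset.powerset_univ]
  refine Finset.sum_nbij' (fun a => Finset.univ.filter fun j => a j = true)
    (fun S j => decide (j ∈ S)) (by simp) (by simp) (fun a _ => by ext j; simp)
    (fun S _ => by ext j; simp) fun a _ => ?_
  rw [smul_eq_mul]
  congr 1
  rw [measureReal_def, Measure.pi_singleton, ENNReal.toReal_prod,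
    ← Finset.prod_sdiff (Finset.subset_univ (Finset.univ.filter fun j => a j = true)), mul_comm]
  congr 1 <;> refine Finset.prod_congr rfl fun j hj => ?_
  · have : a j = true := by simpa using hj
    rw [this, ProbabilityTheory.bernoulliMeasure_apply_of_mem_of_notMem _ (.singleton _) (by simp)
      (by simp)]
    simp
  · have : a j = false := by simpa using hj
    rw [this, ProbabilityTheory.bernoulliMeasure_apply_of_notMem_of_mem _ (.singleton _) (by simp)
      (by simp)]
    simp

theorem measureReal_mem_of_law {Ω α : Type*} [DecidableEq α] [Fintype α] [MeasurableSpace Ω]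
    {μ : Measure Ω} {X : Ω → Finset α} {q : α → ℝ}
    (hlaw : ∀ g : Finset α → ℝ, ∫ ω, g (X ω) ∂μ = randSetMean Finset.univ q g) {j : α}
    (hX : MeasurableSet {ω | j ∈ X ω}) : μ.real {ω | j ∈ X ω} = q j := by
  have h := hlaw fun S => if j ∈ S then 1 else 0
  rw [randSetMean.mem (Finset.mem_univ j) q fun _ => 1, randSetMean.const, mul_one] at h
  rw [← h, ← integral_indicator_one hX]
  simp [Set.indicator_apply]

/-- Resampling one coordinate does not change a product measure. -/
theorem map_update_pi {ι : Type*} [Fintype ι] [DecidableEq ι] {X : ι → Type*}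
    [∀ i, MeasurableSpace (X i)] (μ : ∀ i, Measure (X i)) [∀ i, IsProbabilityMeasure (μ i)]
    (i : ι) :
    ((Measure.pi μ).prod (μ i)).map (fun z => Function.update z.1 i z.2) = Measure.pi μ := by
  refine (Measure.pi_eq fun s hs => ?_).symm
  have hm : Measurable fun z : (∀ i, X i) × X i => Function.update z.1 i z.2 := by
    refine measurable_pi_iff.2 fun k => ?_
    rcases eq_or_ne k i with rfl | hk
    · simpa using measurable_snd
    · simp only [Function.update_of_ne hk]
      exact (measurable_pi_apply k).comp measurable_fst
  rw [Measure.map_apply hm (.univ_pi hs)]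
  have : (fun z : (∀ i, X i) × X i => Function.update z.1 i z.2) ⁻¹' Set.univ.pi s =
      (Set.univ.pi (Function.update s i Set.univ)) ×ˢ s i := by
    ext z
    simp only [Set.mem_preimage, Set.mem_univ_pi, Set.mem_prod]
    constructor
    · intro h
      refine ⟨fun k => ?_, by simpa using h i⟩
      rcases eq_or_ne k i with rfl | hk
      · simp
      · simpa [hk] using h k
    · rintro ⟨h, hi⟩ k
      rcases eq_or_ne k i with rfl | hk
      · simpa using hi
      · simpa [hk] using h k
  rw [this, Measure.prod_prod, Measure.pi_pi,
    ← Finset.mul_prod_erase _ _ (Finset.mem_univ i), Function.update_self, measure_univ, one_mul,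
    ← Finset.mul_prod_erase Finset.univ (fun k => μ k (s k)) (Finset.mem_univ i), mul_comm]
  congr 1
  refine Finset.prod_congr rfl fun k hk => ?_
  rw [Function.update_of_ne (Finset.ne_of_mem_erase hk)]

/-! ### Auctions with given availabilities -/

namespace Auction

variable {n m : ℕ}

/-- The set of items that are available to bidder `i`. -/
def availSet (A : Avail n m) (i : Fin n) : Finset (Fin m) :=
  Finset.univ.filter fun j => A i j = true

/-- The set of items that bidder `i` wins with the bids `β` if all items are available to him, while
the other bidders still place the bids `b` on the items available to them. -/
def winSet (M : Fin m → FirstPriceAuction n) (A : Avail n m) (b : Bids n m) (i : Fin n)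
    (β : Fin m → ℝ≥0) : Finset (Fin m) :=
  Finset.univ.filter fun j => (M j).winner (Function.update (placedBids A b j) i (β j)) = some i

/-- The maximal bid that the competitors of bidder `i` place for item `j`. -/
def rivalBid (A : Avail n m) (b : Bids n m) (i : Fin n) (j : Fin m) : ℝ≥0 :=
  (Finset.univ.erase i).sup (placedBids A b j)

/-- The maximal bid that is placed for item `j`. -/
def topBid (A : Avail n m) (b : Bids n m) (j : Fin m) : ℝ≥0 :=
  Finset.univ.sup (placedBids A b j)

theorem rivalBid_le_topBid (A : Avail n m) (b : Bids n m) (i : Fin n) (j : Fin m) :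
    rivalBid A b i j ≤ topBid A b j :=
  Finset.sup_mono (Finset.erase_subset _ _)

/-- Outbidding all competitors suffices to win, whatever the tie-breaking rule. -/
theorem mem_winSet_of_rivalBid_lt (M : Fin m → FirstPriceAuction n) (A : Avail n m) (b : Bids n m)
    (i : Fin n) (β : Fin m → ℝ≥0) {j : Fin m} (h : rivalBid A b i j < β j) :
    j ∈ winSet M A b i β := by
  refine Finset.mem_filter.2 ⟨Finset.mem_univ _, ?_⟩
  rcases hw : (M j).winner (Function.update (placedBids A b j) i (β j)) with _ | k
  · have := (M j).unsold _ hw i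
    rw [Function.update_self] at this
    simp [this] at h
  · by_cases hk : k = i
    · rw [hk]
    · have h1 := (M j).le_of_winner _ _ hw i
      rw [Function.update_self, Function.update_of_ne hk] at h1
      exact absurd (h1.trans (Finset.le_sup (Finset.mem_erase.2 ⟨hk, Finset.mem_univ _⟩))) h.not_ge

theorem placedBids_update (A : Avail n m) (b : Bids n m) (i : Fin n) (d : Fin m → ℝ≥0)
    (j : Fin m) :
    placedBids A (Function.update b i d) j =
      Function.update (placedBids A b j) i (if A i j then d j else 0) := by
  ext k
  rcases eq_or_ne k i with rfl | hk
  · simp [placedBids]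
  · simp [placedBids, hk]

theorem won_update (M : Fin m → FirstPriceAuction n) (A : Avail n m) (b : Bids n m) (i : Fin n)
    (T : Finset (Fin m)) (β : Fin m → ℝ≥0) :
    won M A (Function.update b i fun j => if j ∈ T then β j else 0) i =
      (T ∩ availSet A i) ∩ winSet M A b i β := by
  ext j
  simp only [won, availSet, winSet, placedBids_update, Finset.mem_filter, Finset.mem_univ,
    true_and, Finset.mem_inter]
  by_cases hA : A i j = true <;> by_cases hT : j ∈ T <;> simp only [hA, hT, if_true, if_false,
    true_and, false_and, and_false, iff_false, Bool.false_eq_true, ite_self] <;>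
  · intro h
    simpa using (M j).pos_of_winner _ _ h

theorem utility_update (M : Fin m → FirstPriceAuction n) (v : Fin n → Finset (Fin m) → ℝ≥0)
    (A : Avail n m) (b : Bids n m) (i : Fin n) (T : Finset (Fin m)) (β : Fin m → ℝ≥0) :
    utility M v A (Function.update b i fun j => if j ∈ T then β j else 0) i =
      (v i ((T ∩ availSet A i) ∩ winSet M A b i β) : ℝ) -
        ∑ j ∈ (T ∩ availSet A i) ∩ winSet M A b i β, (β j : ℝ) := by
  rw [utility, payment, won_update, NNReal.coe_sum]
  congr 1
  refine Finset.sum_congr rfl fun j hj => ?_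
  simp only [Finset.mem_inter, availSet, Finset.mem_filter] at hj
  rw [placedBids_update, Function.update_self, if_pos hj.1.2.2, if_pos hj.1.1]

/-- The revenue: in each auction the maximal bid is paid. -/
theorem sum_payment (M : Fin m → FirstPriceAuction n) (A : Avail n m) (b : Bids n m) :
    ∑ i, payment M A b i = ∑ j, topBid A b j := by
  simp only [payment, won, Finset.sum_filter]
  rw [Finset.sum_comm]
  refine Finset.sum_congr rfl fun j _ => ?_
  rcases hw : (M j).winner (placedBids A b j) with _ | k
  · have := (M j).unsold _ hw
    simp only [reduceCtorEq, if_false, Finset.sum_const_zero]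
    exact (le_antisymm (Finset.sup_le fun i _ => (this i).le) bot_le).symm
  · simp only [Option.some.injEq, Finset.sum_ite_eq, Finset.mem_univ, if_true]
    exact le_antisymm (Finset.le_sup (f := placedBids A b j) (Finset.mem_univ k))
      (Finset.sup_le fun i _ => (M j).le_of_winner _ _ hw i)

/-! ### Measurability -/

theorem measurable_placedBids (j : Fin m) :
    Measurable fun ω : Avail n m × Bids n m => placedBids ω.1 ω.2 j := by
  refine measurable_pi_iff.2 fun i => Measurable.ite ?_ ?_ measurable_const
  · have : Measurable fun ω : Avail n m × Bids n m => ω.1 i j := by fun_prop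
    exact this (.singleton true)
  · fun_prop

theorem measurable_finset_sup_placedBids (s : Finset (Fin n)) (j : Fin m) :
    Measurable fun ω : Avail n m × Bids n m => s.sup (placedBids ω.1 ω.2 j) := by
  induction s using Finset.induction_on with
  | empty => simp
  | insert i s _ ih =>
    simp only [Finset.sup_insert]
    exact ((measurable_pi_apply i).comp (measurable_placedBids j)).sup ih

theorem measurable_topBid (j : Fin m) :
    Measurable fun ω : Avail n m × Bids n m => topBid ω.1 ω.2 j :=
  measurable_finset_sup_placedBids _ j

theorem measurable_rivalBid (i : Fin n) (j : Fin m) :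
    Measurable fun ω : Avail n m × Bids n m => rivalBid ω.1 ω.2 i j :=
  measurable_finset_sup_placedBids _ j

theorem measurable_comp_won (M : Fin m → FirstPriceAuction n) (i : Fin n) {β : Type*}
    [MeasurableSpace β] (g : Finset (Fin m) → β) :
    Measurable fun ω : Avail n m × Bids n m => g (won M ω.1 ω.2 i) :=
  measurable_comp_filter (Ω := Avail n m × Bids n m)
    (p := fun ω j => (M j).winner (placedBids ω.1 ω.2 j) = some i)
    (fun j => measurable_placedBids j ((M j).measurableSet_winner (some i))) g

theorem measurableSet_mem_winSet (M : Fin m → FirstPriceAuction n) (i : Fin n) (β : Fin m → ℝ≥0)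
    (j : Fin m) : MeasurableSet {ω : Avail n m × Bids n m | j ∈ winSet M ω.1 ω.2 i β} := by
  simp only [winSet, Finset.mem_filter, Finset.mem_univ, true_and]
  exact ((measurable_update_left).comp (measurable_placedBids j))
    ((M j).measurableSet_winner (some i))

theorem measurable_comp_winSet (M : Fin m → FirstPriceAuction n) (i : Fin n) (β : Fin m → ℝ≥0)
    (g : Finset (Fin m) → ℝ) :
    Measurable fun ω : Avail n m × Bids n m => g (winSet M ω.1 ω.2 i β) := by
  have := measurable_comp_filter (p := fun (ω : Avail n m × Bids n m) j =>
    j ∈ winSet M ω.1 ω.2 i β) (measurableSet_mem_winSet M i β) g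
  simpa only [Finset.filter_mem_eq_inter, Finset.univ_inter] using this

theorem measurableSet_mem_availSet (i : Fin n) (j : Fin m) :
    MeasurableSet {ω : Avail n m × Bids n m | j ∈ availSet ω.1 i} := by
  simp only [availSet, Finset.mem_filter, Finset.mem_univ, true_and]
  have : Measurable fun ω : Avail n m × Bids n m => ω.1 i j := by fun_prop
  exact this (.singleton true)

theorem measurable_comp_inter (M : Fin m → FirstPriceAuction n) (i : Fin n) (β : Fin m → ℝ≥0)
    (T : Finset (Fin m)) (g : Finset (Fin m) → ℝ) :
    Measurable fun ω : Avail n m × Bids n m =>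
      g ((T ∩ availSet ω.1 i) ∩ winSet M ω.1 ω.2 i β) := by
  have h := measurable_comp_filter (Ω := Avail n m × Bids n m)
    (p := fun ω j => j ∈ (T ∩ availSet ω.1 i) ∩ winSet M ω.1 ω.2 i β) (fun j => by
      simp only [Finset.mem_inter]
      exact ((MeasurableSet.const _).inter (measurableSet_mem_availSet i j)).inter
        (measurableSet_mem_winSet M i β j)) g
  simpa only [Finset.filter_mem_eq_inter, Finset.univ_inter] using h

end Auction

/-! ### Utility guarantees of a single bidder -/

namespace Auction

variable {n m : ℕ}

section Bidder

variable {M : Fin m → FirstPriceAuction n} {v : Fin n → Finset (Fin m) → ℝ≥0} {i : Fin n}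
  {P : Measure (Avail n m × Bids n m)} {U : ℝ}

theorem integrable_rivalBid {j : Fin m}
    (htop : Integrable (fun ω => (topBid ω.1 ω.2 j : ℝ)) P) (i : Fin n) :
    Integrable (fun ω => (rivalBid ω.1 ω.2 i j : ℝ)) P :=
  htop.mono' (measurable_rivalBid i j).coe_nnreal_real.aestronglyMeasurable
    (Eventually.of_forall fun ω => by
      rw [Real.norm_of_nonneg (NNReal.coe_nonneg _)]
      exact NNReal.coe_le_coe.2 (rivalBid_le_topBid _ _ _ _))

theorem integral_rivalBid_le {j : Fin m}
    (htop : Integrable (fun ω => (topBid ω.1 ω.2 j : ℝ)) P) (i : Fin n) :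
    ∫ ω, (rivalBid ω.1 ω.2 i j : ℝ) ∂P ≤ ∫ ω, (topBid ω.1 ω.2 j : ℝ) ∂P :=
  integral_mono (integrable_rivalBid htop i) htop fun _ =>
    NNReal.coe_le_coe.2 (rivalBid_le_topBid _ _ _ _)

theorem integrable_deviation [IsProbabilityMeasure P] (g : Finset (Fin m) → ℝ) (T : Finset (Fin m))
    (β : Fin m → ℝ≥0) :
    Integrable (fun ω : Avail n m × Bids n m =>
      g ((T ∩ availSet ω.1 i) ∩ winSet M ω.1 ω.2 i β)) P :=
  integrable_comp_finset _ g (measurable_comp_inter M i β T g)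

/-- The deviation that bids `β` on a random set of items and `0` elsewhere. -/
theorem randSetMean_deviation_le
    (hdev : ∀ d, ∫ ω, utility M v ω.1 (Function.update ω.2 i d) i ∂P ≤ U)
    {r : Fin m → ℝ} (hr0 : ∀ j, 0 ≤ r j) (hr1 : ∀ j, r j ≤ 1) (β : Fin m → ℝ≥0) :
    randSetMean Finset.univ r (fun T => ∫ ω,
      ((v i ((T ∩ availSet ω.1 i) ∩ winSet M ω.1 ω.2 i β) : ℝ) -
        ∑ j ∈ (T ∩ availSet ω.1 i) ∩ winSet M ω.1 ω.2 i β, (β j : ℝ)) ∂P) ≤ U := by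
  refine (randSetMean.mono hr0 hr1 fun T _ => ?_).trans (randSetMean.const Finset.univ r U).le
  have h := hdev fun j => if j ∈ T then β j else 0
  simpa only [utility_update] using h

/-- The guarantee of a bidder whose availabilities are independent of the bids of the others (`hind`).
The probabilities `q` are those of availability, `r` those of the random set on which he bids. -/
theorem utility_bound_of_indep [IsProbabilityMeasure P]
    (hmono : Monotone (v i)) (hsub : IsSubmodular (v i))
    (hdev : ∀ d, ∫ ω, utility M v ω.1 (Function.update ω.2 i d) i ∂P ≤ U)
    (htop : ∀ j, Integrable (fun ω => (topBid ω.1 ω.2 j : ℝ)) P)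
    {q r : Fin m → ℝ} (hq0 : ∀ j, 0 ≤ q j) (hq1 : ∀ j, q j ≤ 1) (hr0 : ∀ j, 0 ≤ r j)
    (hr1 : ∀ j, r j ≤ 1)
    (hind : ∀ (β : Fin m → ℝ≥0) (G : Finset (Fin m) → Finset (Fin m) → ℝ),
      ∫ ω, G (availSet ω.1 i) (winSet M ω.1 ω.2 i β) ∂P =
        ∫ ω, randSetMean Finset.univ q (fun S => G S (winSet M ω.1 ω.2 i β)) ∂P) :
    (1 - 1 / Real.exp 1) * randSetMean Finset.univ (fun j => r j * q j) (fun S => (v i S : ℝ)) -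
      ∑ j, r j * q j * ∫ ω, (topBid ω.1 ω.2 j : ℝ) ∂P ≤ U := by
  set f : Finset (Fin m) → ℝ := fun S => (v i S : ℝ) with hf
  set x : Fin m → ℝ := fun j => r j * q j with hx
  have hfm : Monotone f := fun S T h => NNReal.coe_le_coe.2 (hmono h)
  have hfs : DecreasingMarginals f := hsub.decreasingMarginals hmono
  have hx0 : ∀ j, 0 ≤ x j := fun j => mul_nonneg (hr0 j) (hq0 j)
  have hx1 : ∀ j, x j ≤ 1 := fun j => mul_le_one₀ (hr1 j) (hq0 j) (hq1 j)
  choose b hb0 hbw hb using fun j => exists_good_bid P (measurable_rivalBid i j).coe_nnreal_real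
    (fun ω => NNReal.coe_nonneg _) (integrable_rivalBid (htop j) i)
    (meanMarginal_nonneg hfm hx0 hx1 j)
  set β : Fin m → ℝ≥0 := fun j => ⟨b j, hb0 j⟩ with hβ
  have hβb : ∀ j, (β j : ℝ) = b j := fun j => rfl
  set Z : Avail n m × Bids n m → Finset (Fin m) := fun ω => winSet M ω.1 ω.2 i β with hZ
  have hZm : ∀ j, MeasurableSet {ω | j ∈ Z ω} := measurableSet_mem_winSet M i β
  have hZi : ∀ g : Finset (Fin m) → ℝ, Integrable (fun ω => g (Z ω)) P := fun g =>
    integrable_comp_finset Z g (measurable_comp_winSet M i β g)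
  have h1 := randSetMean_deviation_le hdev hr0 hr1 β
  have h2 : ∀ T, ∫ ω, (f ((T ∩ availSet ω.1 i) ∩ Z ω) -
        ∑ j ∈ (T ∩ availSet ω.1 i) ∩ Z ω, (β j : ℝ)) ∂P =
      ∫ ω, randSetMean Finset.univ q (fun S => f ((T ∩ S) ∩ Z ω) -
        ∑ j ∈ (T ∩ S) ∩ Z ω, (β j : ℝ)) ∂P := fun T =>
    hind β fun S W => f ((T ∩ S) ∩ W) - ∑ j ∈ (T ∩ S) ∩ W, (β j : ℝ)
  -- Averaged over `T` and the resampled availabilities, the item set `T ∩ S` has marginals `x`.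
  have h3 : ∫ ω, (f ∅ + ∑ j ∈ Z ω, x j * (meanMarginal f x j - β j)) ∂P ≤ U := by
    refine le_trans ?_ h1
    rw [randSetMean.congr fun T _ => h2 T, randSetMean.integral fun T =>
      hZi fun W => randSetMean Finset.univ q (fun S => f ((T ∩ S) ∩ W) -
        ∑ j ∈ (T ∩ S) ∩ W, (β j : ℝ))]
    refine integral_mono (hZi fun W => f ∅ + ∑ j ∈ W, x j * (meanMarginal f x j - β j))
      (hZi fun W => randSetMean Finset.univ r fun T =>
        randSetMean Finset.univ q (fun S => f ((T ∩ S) ∩ W) -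
        ∑ j ∈ (T ∩ S) ∩ W, (β j : ℝ))) fun ω => ?_
    simp only
    rw [randSetMean.inter _ _ _ fun R => f (R ∩ Z ω) - ∑ j ∈ R ∩ Z ω, (β j : ℝ)]
    exact additive_bound_of_fixed_prices hfs hx0 hx1 (Z ω) fun j => (β j : ℝ)
  have h4 : ∫ ω, (f ∅ + ∑ j ∈ Z ω, x j * (meanMarginal f x j - β j)) ∂P =
      f ∅ + ∑ j, P.real {ω | j ∈ Z ω} * (x j * (meanMarginal f x j - β j)) := by
    have he : ∀ ω, ∑ j ∈ Z ω, x j * (meanMarginal f x j - β j) =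
        ∑ j, {ω | j ∈ Z ω}.indicator (fun _ => x j * (meanMarginal f x j - β j)) ω := fun ω => by
      simp only [Set.indicator_apply, Set.mem_ofPred_eq]
      rw [← Finset.sum_filter, Finset.filter_mem_eq_inter, Finset.univ_inter]
    have hi : ∀ j, Integrable
        ({ω | j ∈ Z ω}.indicator fun _ => x j * (meanMarginal f x j - β j)) P := fun j =>
      (integrable_const _).indicator (hZm j)
    simp only [he]
    rw [integral_add (integrable_const _) (integrable_finsetSum _ fun j _ => hi j),
      integral_finsetSum _ fun j _ => hi j]
    simp [integral_indicator_const _ (hZm _)]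
  -- The choice of `β j`. Tied bids may win as well, which does no harm as `β j ≤ w j`.
  have h5 : ∀ j, x j * ((1 - 1 / Real.exp 1) * meanMarginal f x j) -
      x j * ∫ ω, (topBid ω.1 ω.2 j : ℝ) ∂P ≤
      P.real {ω | j ∈ Z ω} * (x j * (meanMarginal f x j - β j)) := by
    intro j
    have e1 : P.real {ω | (rivalBid ω.1 ω.2 i j : ℝ) < b j} ≤ P.real {ω | j ∈ Z ω} :=
      measureReal_mono fun ω h => mem_winSet_of_rivalBid_lt M ω.1 ω.2 i β (NNReal.coe_lt_coe.1 h)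
    have e2 := hb j
    have e3 := integral_rivalBid_le (htop j) i
    have e4 := mul_le_mul_of_nonneg_right e1 (sub_nonneg.2 (hbw j))
    rw [probReal_univ, mul_one] at e2
    rw [hβb, ← mul_sub, mul_left_comm]
    exact mul_le_mul_of_nonneg_left (by linarith) (hx0 j)
  have h6 := Finset.sum_le_sum fun j (_ : j ∈ Finset.univ) => h5 j
  rw [Finset.sum_sub_distrib] at h6
  have h7 := add_sum_meanMarginal f x
  have h8 : ∑ j, x j * ((1 - 1 / Real.exp 1) * meanMarginal f x j) =
      (1 - 1 / Real.exp 1) * ∑ j, x j * meanMarginal f x j := by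
    rw [Finset.mul_sum]
    exact Finset.sum_congr rfl fun j _ => by ring
  have h9 : (1 - 1 / Real.exp 1) * f ∅ ≤ f ∅ := by
    refine mul_le_of_le_one_left (NNReal.coe_nonneg _) ?_
    have : 0 < 1 / Real.exp 1 := by positivity
    linarith
  rw [← h7, mul_add]
  linarith

/-- The guarantee of a bidder whose availabilities have independent coordinates, but may be
correlated with the bids of the others. In contrast to `utility_bound_of_indep`, the price term is
`r j` times the full price, since the price of `j` may be `0` unless `j` is available. -/
theorem utility_bound_of_law [IsProbabilityMeasure P]
    (hmono : Monotone (v i)) (hsub : IsSubmodular (v i))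
    (hdev : ∀ d, ∫ ω, utility M v ω.1 (Function.update ω.2 i d) i ∂P ≤ U)
    (htop : ∀ j, Integrable (fun ω => (topBid ω.1 ω.2 j : ℝ)) P)
    {q r : Fin m → ℝ} (hq0 : ∀ j, 0 ≤ q j) (hq1 : ∀ j, q j ≤ 1) (hr0 : ∀ j, 0 ≤ r j)
    (hr1 : ∀ j, r j ≤ 1)
    (hlaw : ∀ g : Finset (Fin m) → ℝ,
      ∫ ω, g (availSet ω.1 i) ∂P = randSetMean Finset.univ q g) :
    (1 / 2 - 1 / Real.exp 1) *
        randSetMean Finset.univ (fun j => r j * q j) (fun S => (v i S : ℝ)) -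
      ∑ j, r j * ∫ ω, (topBid ω.1 ω.2 j : ℝ) ∂P ≤ U := by
  set f : Finset (Fin m) → ℝ := fun S => (v i S : ℝ) with hf
  set x : Fin m → ℝ := fun j => r j * q j with hx
  have hfm : Monotone f := fun S T h => NNReal.coe_le_coe.2 (hmono h)
  have hfs : DecreasingMarginals f := hsub.decreasingMarginals hmono
  have hx0 : ∀ j, 0 ≤ x j := fun j => mul_nonneg (hr0 j) (hq0 j)
  have hx1 : ∀ j, x j ≤ 1 := fun j => mul_le_one₀ (hr1 j) (hq0 j) (hq1 j)
  set w : Fin m → ℝ := meanMarginal f x with hw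
  set a : Fin m → Set (Avail n m × Bids n m) := fun j => {ω | j ∈ availSet ω.1 i} with ha
  have ham : ∀ j, MeasurableSet (a j) := fun j => measurableSet_mem_availSet i j
  have hPa : ∀ j, P.real (a j) = q j := fun j => measureReal_mem_of_law hlaw (ham j)
  -- The bid for `j` only matters when `j` is available, so it is chosen against the prices on `a j`.
  choose b hb0 hbw hb using fun j => exists_good_bid (P.restrict (a j))
    (measurable_rivalBid i j).coe_nnreal_real
    (fun ω => NNReal.coe_nonneg _) (integrable_rivalBid (htop j) i).restrict
    (meanMarginal_nonneg hfm hx0 hx1 j)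
  set β : Fin m → ℝ≥0 := fun j => ⟨b j, hb0 j⟩ with hβ
  have hβb : ∀ j, (β j : ℝ) = b j := fun j => rfl
  set Z : Avail n m × Bids n m → Finset (Fin m) := fun ω => winSet M ω.1 ω.2 i β with hZ
  have hZm : ∀ j, MeasurableSet {ω | j ∈ Z ω} := measurableSet_mem_winSet M i β
  set c : Fin m → ℝ := fun j => P.real (a j ∩ {ω | j ∈ Z ω}) * (w j - β j) with hc
  set h : Finset (Fin m) → ℝ := fun R => ∑ j ∈ R, max (w j - precMarginal f R j) 0 with hh
  have hhi : ∀ T, Integrable (fun ω : Avail n m × Bids n m => h (T ∩ availSet ω.1 i)) P :=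
    fun T => integrable_comp_finset (fun ω : Avail n m × Bids n m => T ∩ availSet ω.1 i) h (by
      have := measurable_comp_filter (Ω := Avail n m × Bids n m)
        (p := fun ω j => j ∈ T ∩ availSet ω.1 i) (fun j => by
          simp only [Finset.mem_inter]
          exact (MeasurableSet.const _).inter (ham j)) h
      simpa only [Finset.filter_mem_eq_inter, Finset.univ_inter] using this)
  have hTi : ∀ g : Finset (Fin m) → ℝ, ∀ T, Integrable
      (fun ω => g ((T ∩ availSet ω.1 i) ∩ Z ω)) P := fun g T => integrable_deviation g T β
  have h1 := randSetMean_deviation_le hdev hr0 hr1 β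
  have h2 : ∀ T, f ∅ + ∑ j ∈ T, c j - randSetMean Finset.univ q (fun S => h (T ∩ S)) ≤
      ∫ ω, (f ((T ∩ availSet ω.1 i) ∩ Z ω) -
        ∑ j ∈ (T ∩ availSet ω.1 i) ∩ Z ω, (β j : ℝ)) ∂P := by
    intro T
    have e1 : ∫ ω, (f ∅ + ∑ j ∈ (T ∩ availSet ω.1 i) ∩ Z ω, (w j - β j) -
        h (T ∩ availSet ω.1 i)) ∂P ≤ _ :=
      integral_mono ((hTi (fun W => f ∅ + ∑ j ∈ W, (w j - β j)) T).sub (hhi T))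
        (hTi (fun W => f W - ∑ j ∈ W, (β j : ℝ)) T) fun ω =>
        additive_bound_with_shortfall hfs w (fun j => (β j : ℝ)) (T ∩ availSet ω.1 i) (Z ω)
    refine le_trans (le_of_eq ?_) e1
    have he : ∀ ω : Avail n m × Bids n m, ∑ j ∈ (T ∩ availSet ω.1 i) ∩ Z ω, (w j - β j) =
        ∑ j ∈ T, (a j ∩ {ω | j ∈ Z ω}).indicator (fun _ => w j - (β j : ℝ)) ω := fun ω => by
      simp only [Set.indicator_apply, Set.mem_inter_iff, Set.mem_ofPred_eq, ha]
      rw [← Finset.sum_filter, Finset.inter_assoc]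
      refine Finset.sum_congr ?_ fun _ _ => rfl
      ext j
      simp
    have hi : ∀ j, Integrable ((a j ∩ {ω | j ∈ Z ω}).indicator
        fun _ => w j - (β j : ℝ)) P := fun j =>
      (integrable_const _).indicator ((ham j).inter (hZm j))
    rw [integral_sub (hTi (fun W => f ∅ + ∑ j ∈ W, (w j - β j)) T) (hhi T),
      hlaw fun S => h (T ∩ S)]
    simp only [he]
    rw [integral_add (integrable_const _) (integrable_finsetSum _ fun j _ => hi j),
      integral_finsetSum _ fun j _ => hi j]
    simp [integral_indicator_const _ ((ham _).inter (hZm _)), hc]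
  have h3 := (randSetMean.mono hr0 hr1 fun T _ => h2 T).trans h1
  -- Only the mean of the shortfall is needed, so its correlation with the prices is irrelevant.
  rw [randSetMean.sub, randSetMean.add, randSetMean.const, randSetMean.inter,
    randSetMean_sum_mem r (fun _ j => c j) fun _ _ => rfl] at h3
  simp only [randSetMean.const] at h3
  have h4 : randSetMean Finset.univ x h ≤ (∑ j, x j * w j) / 2 :=
    randSetMean_shortfall_le hfm hfs hx0 hx1
  -- The choice of `β j`. Tied bids may win as well, which does no harm as `β j ≤ w j`.
  have h5 : ∀ j, (1 - 1 / Real.exp 1) * (x j * w j) -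
      r j * ∫ ω, (topBid ω.1 ω.2 j : ℝ) ∂P ≤ r j * c j := by
    intro j
    have e1 : (P.restrict (a j)).real {ω | (rivalBid ω.1 ω.2 i j : ℝ) < b j} ≤
        P.real (a j ∩ {ω | j ∈ Z ω}) := by
      rw [measureReal_restrict_apply' (ham j)]
      exact measureReal_mono fun ω h => ⟨h.2,
        mem_winSet_of_rivalBid_lt M ω.1 ω.2 i β (NNReal.coe_lt_coe.1 h.1)⟩
    have e2 := hb j
    have e3 : ∫ ω in a j, (rivalBid ω.1 ω.2 i j : ℝ) ∂P ≤ ∫ ω, (topBid ω.1 ω.2 j : ℝ) ∂P :=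
      (setIntegral_le_integral (integrable_rivalBid (htop j) i)
        (Eventually.of_forall fun ω => NNReal.coe_nonneg _)).trans
        (integral_rivalBid_le (htop j) i)
    have e4 := mul_le_mul_of_nonneg_right e1 (sub_nonneg.2 (hbw j))
    rw [measureReal_restrict_apply_univ, hPa] at e2
    have e5 : (1 - 1 / Real.exp 1) * (x j * w j) = r j * ((1 - 1 / Real.exp 1) * w j * q j) := by
      simp only [hx]; ring
    rw [e5, ← mul_sub]
    refine mul_le_mul_of_nonneg_left ?_ (hr0 j)
    simp only [hc, hβb]
    linarith
  have h6 := Finset.sum_le_sum fun j (_ : j ∈ Finset.univ) => h5 j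
  rw [Finset.sum_sub_distrib, ← Finset.mul_sum] at h6
  have h7 : f ∅ + ∑ j, x j * w j = _ := add_sum_meanMarginal f x
  have h9 : (1 / 2 - 1 / Real.exp 1) * f ∅ ≤ f ∅ := by
    refine mul_le_of_le_one_left (NNReal.coe_nonneg _) ?_
    have : 0 < 1 / Real.exp 1 := by positivity
    linarith
  rw [← h7, mul_add]
  linarith

end Bidder

end Auction

/-! ### Joint laws of availabilities and bids -/

namespace Auction

variable {n m : ℕ}

theorem measurable_applyStrategies : Measurable fun ω : Avail n m × Strategies n m =>
    ((ω.1, fun i => ω.2 i (ω.1 i)) : Avail n m × Bids n m) := by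
  refine measurable_from_prod_countable_right fun A => ?_
  refine measurable_const.prodMk (measurable_pi_iff.2 fun i => ?_)
  exact (measurable_pi_apply (A i)).comp (measurable_pi_apply i)

theorem obliviousCCE_subset_strategicCCE (M : Fin m → FirstPriceAuction n)
    (v : Fin n → Finset (Fin m) → ℝ≥0) (ν : Measure (Avail n m)) [IsProbabilityMeasure ν] (ε : ℝ) :
    obliviousCCE M v ν ε ⊆ strategicCCE M v ν ε := by
  rintro P ⟨D, hD, rfl, hP⟩
  have hm : Measurable fun (b : Bids n m) => ((fun i _ => b i) : Strategies n m) := by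
    refine measurable_pi_iff.2 fun i => measurable_pi_iff.2 fun a => measurable_pi_apply i
  refine ⟨D.map fun b i _ => b i, Measure.isProbabilityMeasure_map hm.aemeasurable, ?_, hP⟩
  have h := Measure.map_prod_map ν D measurable_id hm
  rw [Measure.map_id] at h
  rw [h, Measure.map_map measurable_applyStrategies (measurable_id.prodMap hm)]
  exact Measure.map_id.symm

/-- The items that given bids would win bidder `i` depend neither on his availabilities nor on his
strategy's reaction to them. -/
theorem winSet_update (M : Fin m → FirstPriceAuction n) (A : Avail n m) (s : Strategies n m)
    (i : Fin n) (a : Fin m → Bool) (β : Fin m → ℝ≥0) :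
    winSet M (Function.update A i a) (fun k => s k (Function.update A i a k)) i β =
      winSet M A (fun k => s k (A k)) i β := by
  have h : ∀ j, Function.update (placedBids (Function.update A i a)
      (fun k => s k (Function.update A i a k)) j) i (β j) =
      Function.update (placedBids A (fun k => s k (A k)) j) i (β j) := fun j => by
    ext k
    rcases eq_or_ne k i with rfl | hk
    · simp
    · simp [placedBids, hk]
  simp only [winSet, h]

section Laws

variable {ν : Measure (Avail n m)} {D : Measure (Strategies n m)}

theorem integral_fst_applyStrategies [IsProbabilityMeasure D] (f : Avail n m → ℝ) :
    ∫ ω, f ω.1 ∂((ν.prod D).map fun ω =>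
      ((ω.1, fun i => ω.2 i (ω.1 i)) : Avail n m × Bids n m)) = ∫ A, f A ∂ν := by
  have hf : Measurable fun ω : Avail n m × Bids n m => f ω.1 :=
    (Measurable.of_discrete (f := f)).comp measurable_fst
  rw [integral_map measurable_applyStrategies.aemeasurable hf.aestronglyMeasurable]
  simp [integral_fun_fst]

instance (q : Fin n → Fin m → I) : IsProbabilityMeasure (independentAvail q) := by
  unfold independentAvail; infer_instance

instance (q : Fin m → I) : IsProbabilityMeasure (everybodyOrNobody n q) :=
  Measure.isProbabilityMeasure_map (Measurable.of_discrete).aemeasurable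

theorem integral_independentAvail (q : Fin n → Fin m → I) (i : Fin n)
    (g : Finset (Fin m) → ℝ) :
    ∫ A, g (availSet A i) ∂(independentAvail q) =
      randSetMean Finset.univ (fun j => (q i j : ℝ)) g := by
  have h := (measurePreserving_eval (fun i => Measure.pi fun j =>
    ProbabilityTheory.bernoulliMeasure true false (q i j)) i).map_eq
  rw [← integral_pi_bernoulli, ← h, integral_map (measurable_pi_apply i).aemeasurable
    (Measurable.of_discrete).aestronglyMeasurable]
  rfl

theorem integral_everybodyOrNobody (q : Fin m → I) (i : Fin n) (g : Finset (Fin m) → ℝ) :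
    ∫ A, g (availSet A i) ∂(everybodyOrNobody n q) =
      randSetMean Finset.univ (fun j => (q j : ℝ)) g := by
  rw [← integral_pi_bernoulli, everybodyOrNobody, integral_map
    (Measurable.of_discrete).aemeasurable (Measurable.of_discrete).aestronglyMeasurable]
  rfl

/-- Under independent availability, the availabilities of bidder `i` can be resampled. -/
theorem integral_independentAvail_resample (q : Fin n → Fin m → I) (i : Fin n)
    (f : Avail n m → ℝ) :
    ∫ A, f A ∂(independentAvail q) = ∫ A, randSetMean Finset.univ (fun j => (q i j : ℝ))
      (fun S => f (Function.update A i fun j => decide (j ∈ S))) ∂(independentAvail q) := by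
  have h := map_update_pi (fun i => Measure.pi fun j =>
    ProbabilityTheory.bernoulliMeasure true false (q i j)) i
  unfold independentAvail
  conv_lhs => rw [← h]
  rw [integral_map (Measurable.of_discrete).aemeasurable
    (Measurable.of_discrete).aestronglyMeasurable, integral_prod _ .of_finite]
  refine integral_congr_ae (Eventually.of_forall fun A => ?_)
  simp only
  rw [← integral_pi_bernoulli]
  refine integral_congr_ae (Eventually.of_forall fun a => ?_)
  simp

theorem measurable_comp_availSet_winSet (M : Fin m → FirstPriceAuction n) (i : Fin n)
    (β : Fin m → ℝ≥0) (G : Finset (Fin m) → Finset (Fin m) → ℝ) :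
    Measurable fun ω : Avail n m × Bids n m => G (availSet ω.1 i) (winSet M ω.1 ω.2 i β) := by
  have hG : ∀ ω : Avail n m × Bids n m, G (availSet ω.1 i) (winSet M ω.1 ω.2 i β) =
      ∑ S, if availSet ω.1 i = S then G S (winSet M ω.1 ω.2 i β) else 0 := fun ω => by
    rw [Finset.sum_ite_eq, if_pos (Finset.mem_univ _)]
  simp only [hG]
  refine Finset.measurable_sum _ fun S _ => Measurable.ite ?_ (measurable_comp_winSet M i β (G S))
    measurable_const
  exact measurable_fst (MeasurableSet.of_discrete (s := {A : Avail n m | availSet A i = S}))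

theorem integrable_comp_availSet_winSet (M : Fin m → FirstPriceAuction n) (i : Fin n)
    (β : Fin m → ℝ≥0) (G : Finset (Fin m) → Finset (Fin m) → ℝ)
    {P : Measure (Avail n m × Bids n m)} [IsFiniteMeasure P] :
    Integrable (fun ω => G (availSet ω.1 i) (winSet M ω.1 ω.2 i β)) P := by
  refine Integrable.of_bound (measurable_comp_availSet_winSet M i β G).aestronglyMeasurable
    (∑ S, ∑ T, ‖G S T‖) (Eventually.of_forall fun ω => ?_)
  refine le_trans ?_ (Finset.single_le_sum (f := fun S => ∑ T, ‖G S T‖)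
    (fun S _ => Finset.sum_nonneg fun _ _ => norm_nonneg _)
    (Finset.mem_univ (availSet ω.1 i)))
  exact Finset.single_le_sum (f := fun T => ‖G (availSet ω.1 i) T‖)
    (fun S _ => norm_nonneg _) (Finset.mem_univ _)

/-- Under independent availability, the availabilities of bidder `i` are independent of the set of
items that given bids win. -/
theorem integral_availSet_winSet (M : Fin m → FirstPriceAuction n) [IsProbabilityMeasure D]
    (q : Fin n → Fin m → I) (i : Fin n) (β : Fin m → ℝ≥0)
    (G : Finset (Fin m) → Finset (Fin m) → ℝ) :
    ∫ ω, G (availSet ω.1 i) (winSet M ω.1 ω.2 i β) ∂(((independentAvail q).prod D).map fun ω =>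
      ((ω.1, fun i => ω.2 i (ω.1 i)) : Avail n m × Bids n m)) =
    ∫ ω, randSetMean Finset.univ (fun j => (q i j : ℝ))
      (fun S => G S (winSet M ω.1 ω.2 i β)) ∂(((independentAvail q).prod D).map fun ω =>
      ((ω.1, fun i => ω.2 i (ω.1 i)) : Avail n m × Bids n m)) := by
  have hfub : ∀ G : Finset (Fin m) → Finset (Fin m) → ℝ,
      ∫ ω, G (availSet ω.1 i) (winSet M ω.1 ω.2 i β) ∂(((independentAvail q).prod D).map fun ω =>
        ((ω.1, fun i => ω.2 i (ω.1 i)) : Avail n m × Bids n m)) =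
      ∫ s, ∫ A, G (availSet A i) (winSet M A (fun k => s k (A k)) i β) ∂(independentAvail q) ∂D := by
    intro G
    have : IsProbabilityMeasure (((independentAvail q).prod D).map fun ω =>
        ((ω.1, fun i => ω.2 i (ω.1 i)) : Avail n m × Bids n m)) :=
      Measure.isProbabilityMeasure_map measurable_applyStrategies.aemeasurable
    rw [integral_map measurable_applyStrategies.aemeasurable
      (measurable_comp_availSet_winSet M i β G).aestronglyMeasurable]
    exact integral_prod_symm _ ((integrable_map_measure
      (measurable_comp_availSet_winSet M i β G).aestronglyMeasurable
      measurable_applyStrategies.aemeasurable).1 (integrable_comp_availSet_winSet M i β G))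
  refine (hfub G).trans (Eq.trans ?_ (hfub fun _ W =>
    randSetMean Finset.univ (fun j => (q i j : ℝ)) fun S => G S W).symm)
  refine integral_congr_ae (Eventually.of_forall fun s => ?_)
  refine (integral_independentAvail_resample q i _).trans ?_
  refine integral_congr_ae (Eventually.of_forall fun A => ?_)
  simp only [winSet_update]
  refine randSetMean.congr fun S _ => ?_
  congr 1
  ext j
  simp [availSet]

end Laws

/-- An allocation of maximal welfare for every availability profile. -/
theorem exists_optimal_allocation (v : Fin n → Finset (Fin m) → ℝ≥0) :
    ∃ x : Avail n m → Fin m → Option (Fin n), ∀ A, (∀ j i, x A j = some i → A i j = true) ∧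
      optWelfare v A = ∑ i, v i (Finset.univ.filter fun j => x A j = some i) := by
  have h : ∀ A : Avail n m, ∃ x : Fin m → Option (Fin n), (∀ j i, x j = some i → A i j = true) ∧
      optWelfare v A = ∑ i, v i (Finset.univ.filter fun j => x j = some i) := fun A => by
    obtain ⟨x, hx, he⟩ := Finset.exists_mem_eq_sup
      (Finset.univ.filter fun x : Fin m → Option (Fin n) => ∀ j i, x j = some i → A i j = true)
      ⟨fun _ => none, by simp⟩ (fun x => ∑ i, v i (Finset.univ.filter fun j => x j = some i))
    exact ⟨x, (Finset.mem_filter.1 hx).2, he⟩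
  choose x hx using h
  exact ⟨x, hx⟩

/-! ### From utilities to welfare -/

section Welfare

variable {M : Fin m → FirstPriceAuction n} {v : Fin n → Finset (Fin m) → ℝ≥0}
  {P : Measure (Avail n m × Bids n m)}

theorem integrable_value [IsProbabilityMeasure P] (i : Fin n) :
    Integrable (fun ω => (v i (won M ω.1 ω.2 i) : ℝ)) P :=
  integrable_comp_finset (fun ω : Avail n m × Bids n m => won M ω.1 ω.2 i)
    (fun S => (v i S : ℝ)) (measurable_comp_won M i fun S => (v i S : ℝ))

theorem integrable_payment [IsProbabilityMeasure P] {ε : ℝ} (hP : NoRegret M v ε P) (i : Fin n) :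
    Integrable (fun ω => (payment M ω.1 ω.2 i : ℝ)) P := by
  have := (integrable_value (M := M) (v := v) (P := P) i).sub (hP i).1
  refine this.congr (Eventually.of_forall fun ω => ?_)
  simp [utility]

theorem sum_payment_coe (M : Fin m → FirstPriceAuction n) (A : Avail n m) (b : Bids n m) :
    ∑ i, (payment M A b i : ℝ) = ∑ j, (topBid A b j : ℝ) := by
  exact_mod_cast sum_payment M A b

theorem integrable_topBid [IsProbabilityMeasure P] {ε : ℝ} (hP : NoRegret M v ε P) (j : Fin m) :
    Integrable (fun ω => (topBid ω.1 ω.2 j : ℝ)) P := by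
  refine (integrable_finsetSum Finset.univ fun i _ => integrable_payment hP i).mono'
    (measurable_topBid j).coe_nnreal_real.aestronglyMeasurable (Eventually.of_forall fun ω => ?_)
  rw [Real.norm_of_nonneg (NNReal.coe_nonneg _), sum_payment_coe]
  exact Finset.single_le_sum (f := fun j => (topBid ω.1 ω.2 j : ℝ))
    (fun j _ => NNReal.coe_nonneg _) (Finset.mem_univ j)

/-- The smoothness argument: utilities and revenue add up to the welfare, so the guarantees of the
bidders sum up to a welfare guarantee if their price terms are covered by the revenue. -/
theorem welfare_bound [IsProbabilityMeasure P] {ε : ℝ} (hP : NoRegret M v ε P) {lam : ℝ}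
    {V : Fin n → ℝ} {c : Fin n → Fin m → ℝ} (hc : ∀ j, ∑ i, c i j ≤ 1)
    (h : ∀ i, lam * V i - ∑ j, c i j * ∫ ω, (topBid ω.1 ω.2 j : ℝ) ∂P ≤
      ∫ ω, utility M v ω.1 ω.2 i ∂P + ε) :
    lam * ∑ i, V i - n * ε ≤ ∫ ω, ∑ i, (v i (won M ω.1 ω.2 i) : ℝ) ∂P := by
  have h1 := Finset.sum_le_sum fun i (_ : i ∈ Finset.univ) => h i
  rw [Finset.sum_sub_distrib, ← Finset.mul_sum, Finset.sum_add_distrib, Finset.sum_const,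
    Finset.card_univ, Fintype.card_fin, nsmul_eq_mul, Finset.sum_comm] at h1
  have h2 : ∑ j, ∑ i, c i j * ∫ ω, (topBid ω.1 ω.2 j : ℝ) ∂P ≤
      ∑ j, ∫ ω, (topBid ω.1 ω.2 j : ℝ) ∂P := by
    refine Finset.sum_le_sum fun j _ => ?_
    rw [← Finset.sum_mul]
    exact mul_le_of_le_one_left (integral_nonneg fun ω => NNReal.coe_nonneg _) (hc j)
  have h3 : ∫ ω, ∑ i, (v i (won M ω.1 ω.2 i) : ℝ) ∂P =
      ∑ i, ∫ ω, utility M v ω.1 ω.2 i ∂P + ∑ j, ∫ ω, (topBid ω.1 ω.2 j : ℝ) ∂P := by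
    rw [← integral_finsetSum _ fun i _ => (hP i).1,
      ← integral_finsetSum _ fun j _ => integrable_topBid hP j,
      ← integral_add (integrable_finsetSum _ fun i _ => (hP i).1)
        (integrable_finsetSum _ fun j _ => integrable_topBid hP j)]
    refine integral_congr_ae (Eventually.of_forall fun ω => ?_)
    simp only [← sum_payment_coe M, ← Finset.sum_add_distrib, utility, sub_add_cancel]
  linarith

theorem expectedWelfare_eq_ofReal [IsProbabilityMeasure P] :
    expectedWelfare M v P = ENNReal.ofReal (∫ ω, ∑ i, (v i (won M ω.1 ω.2 i) : ℝ) ∂P) := by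
  rw [expectedWelfare, ofReal_integral_eq_lintegral_ofReal
    (integrable_finsetSum _ fun i _ => integrable_value i)
    (Eventually.of_forall fun ω => Finset.sum_nonneg fun i _ => NNReal.coe_nonneg _)]
  refine lintegral_congr fun ω => ?_
  rw [← NNReal.coe_sum, ENNReal.ofReal_coe_nnreal]

theorem expectedOpt_eq_ofReal (v : Fin n → Finset (Fin m) → ℝ≥0) (ν : Measure (Avail n m))
    [IsProbabilityMeasure ν] :
    expectedOpt v ν = ENNReal.ofReal (∫ A, (optWelfare v A : ℝ) ∂ν) := by
  rw [expectedOpt, ofReal_integral_eq_lintegral_ofReal .of_finite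
    (Eventually.of_forall fun ω => NNReal.coe_nonneg _)]
  exact lintegral_congr fun ω => by rw [ENNReal.ofReal_coe_nnreal]

end Welfare

/-! ### Welfare guarantees and the price of anarchy -/

section Admission

variable {M : Fin m → FirstPriceAuction n} {v : Fin n → Finset (Fin m) → ℝ≥0}

/-- In an allocation that respects availability, item `j` is assigned with at most the probability
that it is available to somebody. -/
theorem sum_measureReal_alloc_le (ν : Measure (Avail n m)) [IsProbabilityMeasure ν]
    {x : Avail n m → Fin m → Option (Fin n)} (hx : ∀ A j i, x A j = some i → A i j = true)
    (j : Fin m) :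
    ∑ i, ν.real {A | x A j = some i} ≤ ν.real {A | ∃ i, A i j = true} := by
  rw [← measureReal_biUnion_finset (fun i _ k _ hik => ?_) fun i _ => .of_discrete]
  · refine measureReal_mono fun A hA => ?_
    simp only [Finset.mem_univ, Set.iUnion_true, Set.mem_iUnion, Set.mem_ofPred_eq] at hA
    exact hA.imp fun i hi => hx A j i hi
  · refine Set.disjoint_left.2 fun A (h1 : x A j = some i) (h2 : x A j = some k) => hik ?_
    rw [h1] at h2
    exact Option.some.inj h2

/-- The marginals of an optimal allocation. By the correlation gap, replacing it by independent
assignments with the same marginals loses at most a factor `1 - 1/e`. -/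
theorem exists_marginals (hmono : ∀ i, Monotone (v i)) (hsub : ∀ i, IsSubmodular (v i))
    (ν : Measure (Avail n m)) [IsProbabilityMeasure ν] {q : Fin n → Fin m → ℝ}
    (hlaw : ∀ i, ∀ g : Finset (Fin m) → ℝ,
      ∫ A, g (availSet A i) ∂ν = randSetMean Finset.univ (q i) g) :
    ∃ y : Fin n → Fin m → ℝ, (∀ i j, 0 ≤ y i j) ∧ (∀ i j, y i j ≤ q i j) ∧
      (∀ j, ∑ i, y i j ≤ ν.real {A | ∃ i, A i j = true}) ∧
      (1 - 1 / Real.exp 1) * ∫ A, (optWelfare v A : ℝ) ∂ν ≤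
        ∑ i, randSetMean Finset.univ (y i) (fun S => (v i S : ℝ)) := by
  obtain ⟨x, hx⟩ := exists_optimal_allocation v
  refine ⟨fun i j => ν.real {A | x A j = some i}, fun i j => measureReal_nonneg, fun i j => ?_,
    sum_measureReal_alloc_le ν fun A => (hx A).1, ?_⟩
  · rw [← measureReal_mem_of_law (hlaw i) (j := j) .of_discrete]
    exact measureReal_mono fun A hA => by
      simpa [availSet] using (hx A).1 j i hA
  · have hopt : ∫ A, (optWelfare v A : ℝ) ∂ν =
        ∑ i, ∫ A, (v i (Finset.univ.filter fun j => x A j = some i) : ℝ) ∂ν := by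
      rw [← integral_finsetSum _ fun i _ => .of_finite]
      refine integral_congr_ae (Eventually.of_forall fun A => ?_)
      simp only [(hx A).2, NNReal.coe_sum]
    rw [hopt, Finset.mul_sum]
    refine Finset.sum_le_sum fun i _ => ?_
    have h := correlation_gap_integral (μ := ν) (v := fun S => (v i S : ℝ))
      (fun S T h => NNReal.coe_le_coe.2 (hmono i h)) (NNReal.coe_nonneg _)
      ((hsub i).decreasingMarginals (hmono i))
      (fun A => Finset.univ.filter fun j => x A j = some i) fun g => .of_discrete
    simpa only [Finset.mem_filter, Finset.mem_univ, true_and] using h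

theorem div_mul_cancel_of_nonneg_of_le {a b : ℝ} (ha : 0 ≤ a) (hab : a ≤ b) : a / b * b = a := by
  rcases eq_or_ne b 0 with rfl | hb
  · rw [mul_zero, le_antisymm hab ha]
  · exact div_mul_cancel₀ a hb

/-- The welfare guarantee under fully independent availability. -/
theorem welfare_bound_independentAvail (hmono : ∀ i, Monotone (v i))
    (hsub : ∀ i, IsSubmodular (v i)) (q : Fin n → Fin m → I) {ε : ℝ}
    {P : Measure (Avail n m × Bids n m)} (hP : P ∈ strategicCCE M v (independentAvail q) ε) :
    (1 - 1 / Real.exp 1) ^ 2 * ∫ A, (optWelfare v A : ℝ) ∂(independentAvail q) - n * ε ≤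
      ∫ ω, ∑ i, (v i (won M ω.1 ω.2 i) : ℝ) ∂P := by
  obtain ⟨D, hD, rfl, hP⟩ := hP
  have hprob : IsProbabilityMeasure (((independentAvail q).prod D).map fun ω =>
      ((ω.1, fun i => ω.2 i (ω.1 i)) : Avail n m × Bids n m)) :=
    Measure.isProbabilityMeasure_map measurable_applyStrategies.aemeasurable
  obtain ⟨y, hy0, hyq, hysum, hopt⟩ := exists_marginals hmono hsub (independentAvail q)
    (integral_independentAvail q)
  have hr : ∀ i, (fun j => y i j / q i j * q i j) = y i := fun i =>
    funext fun j => div_mul_cancel_of_nonneg_of_le (hy0 i j) (hyq i j)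
  have h := welfare_bound hP (c := y) (lam := 1 - 1 / Real.exp 1)
    (fun j => (hysum j).trans measureReal_le_one) fun i => by
      have h1 := utility_bound_of_indep (hmono i) (hsub i) (hP i).2 (integrable_topBid hP)
        (q := fun j => (q i j : ℝ)) (r := fun j => y i j / q i j) (fun j => (q i j).2.1)
        (fun j => (q i j).2.2) (fun j => div_nonneg (hy0 i j) (q i j).2.1)
        (fun j => div_le_one_of_le₀ (hyq i j) (q i j).2.1) (integral_availSet_winSet M q i)
      simpa only [congrFun (hr i), hr i] using h1
  have hc0 : 0 ≤ 1 - 1 / Real.exp 1 := by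
    rw [sub_nonneg, div_le_one (by positivity)]
    exact Real.one_le_exp zero_le_one
  refine le_trans ?_ h
  rw [pow_two, mul_assoc]
  exact sub_le_sub_right (mul_le_mul_of_nonneg_left hopt hc0) _

/-- The welfare guarantee under everybody-or-nobody admission. -/
theorem welfare_bound_everybodyOrNobody (hmono : ∀ i, Monotone (v i))
    (hsub : ∀ i, IsSubmodular (v i)) (q : Fin m → I) {ε : ℝ}
    {P : Measure (Avail n m × Bids n m)} (hP : P ∈ strategicCCE M v (everybodyOrNobody n q) ε) :
    (1 / 2 - 1 / Real.exp 1) * (1 - 1 / Real.exp 1) *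
        ∫ A, (optWelfare v A : ℝ) ∂(everybodyOrNobody n q) - n * ε ≤
      ∫ ω, ∑ i, (v i (won M ω.1 ω.2 i) : ℝ) ∂P := by
  obtain ⟨D, hD, rfl, hP⟩ := hP
  have hprob : IsProbabilityMeasure (((everybodyOrNobody n q).prod D).map fun ω =>
      ((ω.1, fun i => ω.2 i (ω.1 i)) : Avail n m × Bids n m)) :=
    Measure.isProbabilityMeasure_map measurable_applyStrategies.aemeasurable
  obtain ⟨y, hy0, hyq, hysum, hopt⟩ := exists_marginals hmono hsub (everybodyOrNobody n q)
    (integral_everybodyOrNobody q)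
  have hr : ∀ i, (fun j => y i j / q j * q j) = y i := fun i =>
    funext fun j => div_mul_cancel_of_nonneg_of_le (hy0 i j) (hyq i j)
  have hq : ∀ j, (everybodyOrNobody n q).real {A | ∃ i, A i j = true} ≤ q j := fun j => by
    rw [everybodyOrNobody, map_measureReal_apply .of_discrete .of_discrete,
      ← measureReal_mem_of_law (integral_pi_bernoulli q) (j := j) .of_discrete]
    exact measureReal_mono fun a ⟨_, ha⟩ => by simpa using ha
  have h := welfare_bound hP (c := fun i j => y i j / q j) (lam := 1 / 2 - 1 / Real.exp 1)
    (fun j => by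
      rw [← Finset.sum_div]
      exact div_le_one_of_le₀ ((hysum j).trans (hq j)) (q j).2.1) fun i => by
      have h1 := utility_bound_of_law (hmono i) (hsub i) (hP i).2 (integrable_topBid hP)
        (q := fun j => (q j : ℝ)) (r := fun j => y i j / q j) (fun j => (q j).2.1)
        (fun j => (q j).2.2) (fun j => div_nonneg (hy0 i j) (q j).2.1)
        (fun j => div_le_one_of_le₀ (hyq i j) (q j).2.1) fun g =>
          (integral_fst_applyStrategies fun A => g (availSet A i)).trans
            (integral_everybodyOrNobody q i g)
      simpa only [hr i] using h1
  have hc0 : 0 ≤ 1 / 2 - 1 / Real.exp 1 := by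
    rw [sub_nonneg]
    refine one_div_le_one_div_of_le two_pos ?_
    linarith [Real.add_one_le_exp 1]
  refine le_trans ?_ h
  rw [mul_assoc]
  exact sub_le_sub_right (mul_le_mul_of_nonneg_left hopt hc0) _

/-- Welfare guarantees translate into bounds on the price of anarchy; as `ε` tends to `0`, the
additive loss becomes negligible because a vanishing optimum contributes the ratio `0`. -/
theorem priceOfAnarchy_bounds (M : Fin m → FirstPriceAuction n) (v : Fin n → Finset (Fin m) → ℝ≥0)
    (ν : Measure (Avail n m)) [IsProbabilityMeasure ν] {lam : ℝ} (hlam : 0 < lam)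
    (h : ∀ ε, ∀ P ∈ strategicCCE M v ν ε, lam * ∫ A, (optWelfare v A : ℝ) ∂ν - n * ε ≤
      ∫ ω, ∑ i, (v i (won M ω.1 ω.2 i) : ℝ) ∂P) :
    priceOfAnarchy M v ν (obliviousCCE M v ν 0) ≤ ENNReal.ofReal (1 / lam) ∧
    limsup (fun ε : ℝ => priceOfAnarchy M v ν (strategicCCE M v ν ε)) (𝓝[>] 0) ≤
      ENNReal.ofReal (1 / lam) := by
  set O : ℝ := ∫ A, (optWelfare v A : ℝ) ∂ν with hO
  have hO0 : 0 ≤ O := integral_nonneg fun A => NNReal.coe_nonneg _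
  have hpoa : ∀ ε, priceOfAnarchy M v ν (strategicCCE M v ν ε) ≤
      ENNReal.ofReal O / ENNReal.ofReal (lam * O - n * ε) := fun ε => by
    refine iSup₂_le fun P hP => ?_
    have hPε := h ε P hP
    obtain ⟨D, hD, rfl, -⟩ := hP
    have hprob : IsProbabilityMeasure ((ν.prod D).map fun ω =>
        ((ω.1, fun i => ω.2 i (ω.1 i)) : Avail n m × Bids n m)) :=
      Measure.isProbabilityMeasure_map measurable_applyStrategies.aemeasurable
    rw [expectedOpt_eq_ofReal, expectedWelfare_eq_ofReal]
    exact ENNReal.div_le_div_left (ENNReal.ofReal_le_ofReal hPε) _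
  rcases hO0.eq_or_lt with hO0 | hO0
  · have hz : ∀ ε, priceOfAnarchy M v ν (strategicCCE M v ν ε) ≤ 0 := fun ε => by
      refine (hpoa ε).trans ?_
      rw [← hO0, ENNReal.ofReal_zero, ENNReal.zero_div]
    refine ⟨(biSup_mono fun P hP => obliviousCCE_subset_strategicCCE M v ν 0 hP).trans
      ((hz 0).trans zero_le), ?_⟩
    simp only [le_antisymm (hz _) zero_le]
    simp
  · have hlO : 0 < lam * O := mul_pos hlam hO0
    constructor
    · refine (biSup_mono fun P hP => obliviousCCE_subset_strategicCCE M v ν 0 hP).trans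
        ((hpoa 0).trans (le_of_eq ?_))
      rw [mul_zero, sub_zero, ← ENNReal.ofReal_div_of_pos hlO]
      congr 1
      field_simp
    · have hlim : Tendsto (fun ε : ℝ => ENNReal.ofReal O / ENNReal.ofReal (lam * O - n * ε))
          (𝓝[>] 0) (𝓝 (ENNReal.ofReal (1 / lam))) := by
        have h1 : Tendsto (fun ε : ℝ => lam * O - n * ε) (𝓝 0) (𝓝 (lam * O)) := by
          have : Continuous fun ε : ℝ => lam * O - n * ε := by fun_prop
          simpa using this.tendsto 0
        have h2 : Tendsto (fun ε : ℝ => ENNReal.ofReal (O / (lam * O - n * ε))) (𝓝[>] 0)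
            (𝓝 (ENNReal.ofReal (1 / lam))) := by
          have : 1 / lam = O / (lam * O) := by field_simp
          rw [this]
          exact (ENNReal.tendsto_ofReal (tendsto_const_nhds.div h1 hlO.ne')).mono_left
            nhdsWithin_le_nhds
        refine h2.congr' ?_
        filter_upwards [nhdsWithin_le_nhds (h1.eventually_const_lt hlO)] with ε hε
        exact ENNReal.ofReal_div_of_pos hε
      exact (limsup_le_limsup (Eventually.of_forall hpoa)).trans hlim.limsup_eq.le

end Admission

end Auction

theorem corollary2 (n m : ℕ) (M : Fin m → FirstPriceAuction n)
    (v : Fin n → Finset (Fin m) → ℝ≥0)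
    (hmono : ∀ i, Monotone (v i)) (hsub : ∀ i, IsSubmodular (v i)) :
    (∀ q : Fin n → Fin m → I,
      Auction.priceOfAnarchy M v (Auction.independentAvail q)
          (Auction.obliviousCCE M v (Auction.independentAvail q) 0)
        ≤ ENNReal.ofReal (1 / (1 - 1 / Real.exp 1) ^ 2) ∧
      limsup (fun ε : ℝ => Auction.priceOfAnarchy M v (Auction.independentAvail q)
          (Auction.strategicCCE M v (Auction.independentAvail q) ε)) (𝓝[>] 0)
        ≤ ENNReal.ofReal (1 / (1 - 1 / Real.exp 1) ^ 2)) ∧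
    (∀ q : Fin m → I,
      Auction.priceOfAnarchy M v (Auction.everybodyOrNobody n q)
          (Auction.obliviousCCE M v (Auction.everybodyOrNobody n q) 0)
        ≤ ENNReal.ofReal (4 / (1 - 1 / Real.exp 1) ^ 3) ∧
      limsup (fun ε : ℝ => Auction.priceOfAnarchy M v (Auction.everybodyOrNobody n q)
          (Auction.strategicCCE M v (Auction.everybodyOrNobody n q) ε)) (𝓝[>] 0)
        ≤ ENNReal.ofReal (4 / (1 - 1 / Real.exp 1) ^ 3)) := by
  have he : 1 / Real.exp 1 < 37 / 100 := by
    rw [div_lt_iff₀ (Real.exp_pos 1)]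
    linarith [Real.exp_one_gt_d9]
  have he0 : 0 < 1 / Real.exp 1 := by positivity
  set c : ℝ := 1 - 1 / Real.exp 1 with hc
  have hc0 : 0 < c := by linarith
  refine ⟨fun q => ?_, fun q => ?_⟩
  · exact Auction.priceOfAnarchy_bounds M v _ (pow_pos hc0 2) fun ε P hP =>
      Auction.welfare_bound_independentAvail hmono hsub q hP
  · have hpos : 0 < (1 / 2 - 1 / Real.exp 1) * c := mul_pos (by linarith) hc0
    -- `1/2 - 1/e ≥ (1 - 1/e)² / 4`, so the guarantee obtained is stronger than the stated one.
    have hle : 1 / ((1 / 2 - 1 / Real.exp 1) * c) ≤ 4 / c ^ 3 := by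
      rw [div_le_div_iff₀ hpos (pow_pos hc0 3)]
      have h1 : c ^ 2 ≤ 4 * (1 / 2 - 1 / Real.exp 1) := by nlinarith
      nlinarith
    have h := Auction.priceOfAnarchy_bounds M v _ hpos fun ε P hP =>
      Auction.welfare_bound_everybodyOrNobody hmono hsub q hP
    exact ⟨h.1.trans (ENNReal.ofReal_le_ofReal hle), h.2.trans (ENNReal.ofReal_le_ofReal hle)⟩
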